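/- Let $1<\alpha<\beta$, let $\Omega=(-\infty,0)\cup(1,\alpha)\cup(\beta,\infty)$, and let $\chi_-,\chi_0,\chi_+$ be the indicator functions of the three components. Write $e(x)=e^{2\pi i x}$ and $e_\lambda(x)=e(\lambda x)$. The maximal momentum operator $P=\frac{1}{2\pi i}\frac{d}{dx}$ in $L^2(\Omega)$ has as domain $\mathcal D(P)$ the absolutely continuous $f\in L^2(\Omega)$ with $f'\in L^2(\Omega)$; such $f$ have one-sided boundary values $f(0),f(1),f(\alpha),f(\beta)$. For $0\le w\le 1$ and $\theta,\phi,\psi\in\mathbb R$ let $$B=\begin{pmatrix} w\,e(\phi) & -\sqrt{1-w^2}\,e(\theta-\psi)\\ \sqrt{1-w^2}\,e(\psi) & w\,e(\theta-\phi)\end{pmatrix}\in U(2),$$ and let $P_B$ be the restriction of $P$ to those $f\in\mathcal D(P)$ with $B\,(f(1),f(\beta))^{T}=(f(0),f(\alpha))^{T}$. A generalized eigenfunction of $P_B$ for $\lambda\in\mathbb R$ is a function $u$ on $\Omega$, integrable on bounded subsets, whose functional $\eta\mapsto\int_\Omega\overline{\eta}\,u$ is a nonzero element of the antidual $\mathcal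 D_B'(\Omega)$ satisfying $\int_\Omega \overline{P\eta}\,u=\lambda\int_\Omega\overline{\eta}\,u$ for all test functions $\eta$, where the test functions are the restrictions to $\Omega$ of functions in $C_c^\infty(\mathbb R)$ that together with all their derivatives satisfy the boundary condition. Uniform multiplicity one means unitary equivalence to multiplication by the variable $\xi$ in $L^2(\mathbb R,\nu)$ (complex-valued functions) for some $\sigma$-finite Borel measure $\nu$. **Theorem 3.8.** Let $w=0$ and $\Lambda=\frac{\psi}{\alpha-1}+\frac{1}{\alpha-1}\mathbb Z$. Then: 1. $P_B$ is self-adjoint, its spectrum is $\mathbb R$, and it has uniform multiplicity one. 2. The spectrum is a mixture of continuous and discrete spectrum: put $\psi_\lambda=(-e(\theta-\psi+\beta\lambda)\chi_-+\chi_+)e_\lambda$ for $\lambda\in\mathbb R$, and let $\nu=d\lambda+\frac1{\alpha-1}\sum_{\mu\in\Lambda}\delta_\mu$. There is a unitary operator $U:L^2(\Omega)\to L^2(\mathbb R,\nu)$ carrying $P_B$ to multiplication by the variable (with its maximal domain) such that $(Uf)(\lambda)=\int_\Omega\overline{\psi_\lambda}f$ for Lebesgue-a.e. $\lambda$ if $f\in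 L^1(\Omega)\cap L^2(\Omega)$, and $(Uf)(\lambda)=\int_\Omega\overline{\chi_0e_\lambda}f$ for every $\lambda\in\Lambda$ and $f\in L^2(\Omega)$. 3. For $\lambda\in\mathbb R$ and $a,b,c\in\mathbb C$, the function $(a\chi_-+b\chi_0+c\chi_+)e_\lambda$ is a generalized eigenfunction of $P_B$ for $\lambda$ if and only if $(a,b,c)\neq0$, $a=-c\,e(\theta-\psi+\beta\lambda)$, and either $b=0$ or $\lambda\in\Lambda$. So with $b=0$ one gets exactly the nonzero multiples of $\psi_\lambda$, for every $\lambda\in\mathbb R$; with $a=c=0$ one gets exactly the nonzero multiples of $\chi_0e_\lambda$, for $\lambda\in\Lambda$ only. 4. The set of eigenvalues of $P_B$ is exactly $\Lambda$; these eigenvalues are embedded in the continuum, each has multiplicity one, and for $\lambda\in\Lambda$ the eigenspace is $\mathbb C\,\chi_0e_\lambda$. -/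

import Mathlib

open MeasureTheory Set
open scoped ContDiff ComplexConjugate

noncomputable section

namespace TwoIntervals

/-! ### Unbounded operators on a Hilbert space -/

section Operators

variable {H : Type*} [NormedAddCommGroup H] [InnerProductSpace ℂ H]

/-- `z` belongs to the resolvent set of `A`: the operator `A - z` is a bijection from the domain
of `A` onto `H`, and its inverse `R` is bounded. -/
def IsResolventPoint (A : H →ₗ.[ℂ] H) (z : ℂ) : Prop :=
  ∃ R : H →L[ℂ] H,
    (∀ x : H, ∃ hx : R x ∈ A.domain, A ⟨R x, hx⟩ - z • R x = x) ∧
    (∀ y : A.domain, R (A y - z • (y : H)) = y)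

/-- The spectrum of an unbounded operator. -/
def opSpectrum (A : H →ₗ.[ℂ] H) : Set ℂ := {z | ¬ IsResolventPoint A z}

/-- The eigenspace `{f ∈ D(A) | A f = z f}`. -/
def opEigenspace (A : H →ₗ.[ℂ] H) (z : ℂ) : Submodule ℂ H where
  carrier := {f | ∃ hf : f ∈ A.domain, A ⟨f, hf⟩ = z • f}
  zero_mem' := ⟨A.domain.zero_mem, by
    rw [smul_zero]; exact A.map_zero⟩
  add_mem' := by
    rintro f g ⟨hf, hf'⟩ ⟨hg, hg'⟩
    refine ⟨A.domain.add_mem hf hg, ?_⟩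
    have h := A.map_add ⟨f, hf⟩ ⟨g, hg⟩
    rw [hf', hg', ← smul_add] at h
    exact h
  smul_mem' := by
    rintro c f ⟨hf, hf'⟩
    refine ⟨A.domain.smul_mem c hf, ?_⟩
    have h := A.map_smul c ⟨f, hf⟩
    rw [hf', smul_comm] at h
    exact h

/-- The set of all eigenvalues (the point spectrum). -/
def opEigenvalues (A : H →ₗ.[ℂ] H) : Set ℂ := {z | opEigenspace A z ≠ ⊥}

/-- The unitary `U : H → L²(ℝ, ν)` carries `A` to multiplication by the variable `ξ`, where the
multiplication operator has its maximal domain `{g ∈ L²(ν) | ξ g ∈ L²(ν)}`. -/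
def IsSpectralRepresentation (A : H →ₗ.[ℂ] H) (ν : Measure ℝ) (U : H ≃ₗᵢ[ℂ] Lp ℂ 2 ν) : Prop :=
  (∀ f : H, f ∈ A.domain ↔ MemLp (fun ξ : ℝ => (ξ : ℂ) * U f ξ) 2 ν) ∧
  (∀ f : A.domain, U (A f) =ᵐ[ν] fun ξ : ℝ => (ξ : ℂ) * U (f : H) ξ)

/-- `A` has uniform multiplicity one: in its direct integral representation
`∫ H(ξ) dν(ξ)` all fibres `H(ξ)` are one dimensional, that is, `A` is unitarily equivalent to
multiplication by the variable in the scalar space `L²(ℝ, ν)`. -/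
def HasUniformMultiplicityOne (A : H →ₗ.[ℂ] H) : Prop :=
  ∃ ν : Measure ℝ, SigmaFinite ν ∧ ∃ U : H ≃ₗᵢ[ℂ] Lp ℂ 2 ν, IsSpectralRepresentation A ν U

end Operators

/-! ### The momentum operator on the exterior of two intervals -/

/-- `e(x) = exp(2 π i x)`. -/
def e (x : ℝ) : ℂ := Complex.exp (2 * Real.pi * Complex.I * x)

/-- `Ω = (-∞, 0) ∪ (1, α) ∪ (β, ∞)`. -/
def Omega (α β : ℝ) : Set ℝ := Iio 0 ∪ Ioo 1 α ∪ Ioi β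

/-- The Hilbert space `L²(Ω)` with respect to Lebesgue measure. -/
abbrev L2Omega (α β : ℝ) : Type := Lp ℂ 2 (volume.restrict (Omega α β))

/-- Absolute continuity on each of `(-∞, 0]`, `[1, α]`, `[β, ∞)` (on compact subintervals).  An
absolutely continuous function on `Ω` whose derivative is in `L²(Ω)` extends in exactly one way to
such a function on the closure of `Ω`; its values at `0, 1, α, β` are the boundary values. -/
structure IsAC (α β : ℝ) (g : ℝ → ℂ) : Prop where
  left : ∀ a ≤ 0, AbsolutelyContinuousOnInterval g a 0
  mid : AbsolutelyContinuousOnInterval g 1 α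
  right : ∀ b ≥ β, AbsolutelyContinuousOnInterval g β b

theorem IsAC.add {α β : ℝ} {g h : ℝ → ℂ} (hg : IsAC α β g) (hh : IsAC α β h) :
    IsAC α β (g + h) :=
  ⟨fun a ha => (hg.left a ha).add (hh.left a ha), hg.mid.add hh.mid,
    fun b hb => (hg.right b hb).add (hh.right b hb)⟩

theorem IsAC.const_smul {α β : ℝ} {g : ℝ → ℂ} (c : ℂ) (hg : IsAC α β g) :
    IsAC α β (c • g) :=
  ⟨fun a ha => (hg.left a ha).const_smul c, hg.mid.const_smul c,
    fun b hb => (hg.right b hb).const_smul c⟩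

theorem isAC_zero (α β : ℝ) : IsAC α β 0 := by
  have h : ∀ a b : ℝ, AbsolutelyContinuousOnInterval (0 : ℝ → ℂ) a b := by
    intro a b
    simpa [AbsolutelyContinuousOnInterval] using tendsto_const_nhds
  exact ⟨fun a _ => h a 0, h 1 α, fun b _ => h β b⟩

/-- The graph of the maximal momentum operator `P = (1 / 2πi) d/dx`: pairs `(f, k)` in `L²(Ω)`
such that `f` has an absolutely continuous version `g` with `g' = 2πi k` almost everywhere. -/
def momentumGraph (α β : ℝ) : Submodule ℂ (L2Omega α β × L2Omega α β) where
  carrier := {p | ∃ g : ℝ → ℂ, IsAC α β g ∧ p.1 =ᵐ[volume.restrict (Omega α β)] g ∧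
    ∀ᵐ x ∂(volume.restrict (Omega α β)),
      HasDerivAt g (2 * Real.pi * Complex.I * p.2 x) x}
  zero_mem' := by
    refine ⟨0, isAC_zero α β, Lp.coeFn_zero _ _ _, ?_⟩
    filter_upwards [Lp.coeFn_zero ℂ 2 (volume.restrict (Omega α β))] with x hx
    have h0 : ((0 : L2Omega α β × L2Omega α β).2 : ℝ → ℂ) x = 0 := hx
    rw [h0, mul_zero]
    exact hasDerivAt_const x (0 : ℂ)
  add_mem' := by
    rintro ⟨f, k⟩ ⟨f', k'⟩ ⟨g, hg, hf, hk⟩ ⟨g', hg', hf', hk'⟩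
    refine ⟨g + g', hg.add hg', (Lp.coeFn_add f f').trans (hf.add hf'), ?_⟩
    filter_upwards [hk, hk', Lp.coeFn_add k k'] with x h1 h2 h3
    have h := h1.add h2
    rw [← mul_add] at h
    change HasDerivAt (g + g') (2 * Real.pi * Complex.I * (k + k' : L2Omega α β) x) x
    rw [h3]
    exact h
  smul_mem' := by
    rintro c ⟨f, k⟩ ⟨g, hg, hf, hk⟩
    refine ⟨c • g, hg.const_smul c, (Lp.coeFn_smul c f).trans (hf.const_smul c), ?_⟩
    filter_upwards [hk, Lp.coeFn_smul c k] with x h1 h3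
    have h := h1.const_smul c
    change HasDerivAt (c • g) (2 * Real.pi * Complex.I * (c • k : L2Omega α β) x) x
    rw [h3]
    have h4 : 2 * Real.pi * Complex.I * (c • (k : ℝ → ℂ)) x =
        c • (2 * Real.pi * Complex.I * (k : ℝ → ℂ) x) := by
      simp only [Pi.smul_apply, smul_eq_mul]
      ring
    rw [h4]
    exact h

/-- The maximal momentum operator `P` on `L²(Ω)`. -/
def maxMomentum (α β : ℝ) : L2Omega α β →ₗ.[ℂ] L2Omega α β :=
  (momentumGraph α β).toLinearPMap

theorem isOpen_Omega (α β : ℝ) : IsOpen (Omega α β) :=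
  (isOpen_Iio.union isOpen_Ioo).union isOpen_Ioi

theorem IsAC.continuousOn {α β : ℝ} (hα : 1 ≤ α) {g : ℝ → ℂ} (hg : IsAC α β g) :
    ContinuousOn g (Omega α β) := by
  intro x hx
  apply ContinuousAt.continuousWithinAt
  rcases hx with (hx | hx) | hx
  · have hx0 : x < 0 := hx
    have h := (hg.left (x - 1) (by linarith)).continuousOn
    rw [uIcc_of_le (by linarith)] at h
    exact h.continuousAt (Icc_mem_nhds (by linarith) hx0)
  · have h := hg.mid.continuousOn
    rw [uIcc_of_le hα] at h
    exact h.continuousAt (Icc_mem_nhds hx.1 hx.2)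
  · have hx0 : β < x := hx
    have h := (hg.right (x + 1) (by linarith)).continuousOn
    rw [uIcc_of_le (by linarith)] at h
    exact h.continuousAt (Icc_mem_nhds hx0 (by linarith))

/-- The graph is single valued, so that `maxMomentum` really is the operator with this graph. -/
theorem momentumGraph_functional {α β : ℝ} (hα : 1 ≤ α) :
    ∀ p ∈ momentumGraph α β, p.1 = 0 → p.2 = 0 := by
  rintro ⟨f, k⟩ ⟨g, hg, hf, hk⟩ h0
  have hf0 : f = 0 := h0
  subst hf0
  have hg0 : g =ᵐ[volume.restrict (Omega α β)] (0 : ℝ → ℂ) :=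
    hf.symm.trans (Lp.coeFn_zero _ _ _)
  have hz : EqOn g (0 : ℝ → ℂ) (Omega α β) :=
    Measure.eqOn_open_of_ae_eq hg0 (isOpen_Omega α β) (hg.continuousOn hα) continuousOn_const
  refine Lp.ext ?_
  filter_upwards [hk, Lp.coeFn_zero ℂ 2 (volume.restrict (Omega α β)),
    ae_restrict_mem (isOpen_Omega α β).measurableSet] with x h1 h2 h3
  have h4 : HasDerivAt g 0 x :=
    (hasDerivAt_const x (0 : ℂ)).congr_of_eventuallyEq
      (hz.eventuallyEq_of_mem ((isOpen_Omega α β).mem_nhds h3))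
  have h5 := h1.unique h4
  rw [h2]
  simpa [Complex.I_ne_zero, Real.pi_ne_zero] using h5

theorem maxMomentum_graph {α β : ℝ} (hα : 1 ≤ α) :
    (maxMomentum α β).graph = momentumGraph α β :=
  Submodule.toLinearPMap_graph_eq _ fun p hp h => momentumGraph_functional hα p hp h

/-- The boundary condition `B ρ₁(g) = ρ₂(g)`, with `ρ₁(g) = (g(1), g(β))`, `ρ₂(g) = (g(0), g(α))`. -/
def BoundaryCondition (α β : ℝ) (B : Matrix (Fin 2) (Fin 2) ℂ) (g : ℝ → ℂ) : Prop :=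
  B.mulVec ![g 1, g β] = ![g 0, g α]

theorem BoundaryCondition.add {α β : ℝ} {B : Matrix (Fin 2) (Fin 2) ℂ} {g h : ℝ → ℂ}
    (hg : BoundaryCondition α β B g) (hh : BoundaryCondition α β B h) :
    BoundaryCondition α β B (g + h) := by
  unfold BoundaryCondition at *
  have h1 : ![(g + h) 1, (g + h) β] = ![g 1, g β] + ![h 1, h β] := by simp
  rw [h1, Matrix.mulVec_add, hg, hh]
  simp

theorem BoundaryCondition.const_smul {α β : ℝ} {B : Matrix (Fin 2) (Fin 2) ℂ} {g : ℝ → ℂ}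
    (c : ℂ) (hg : BoundaryCondition α β B g) : BoundaryCondition α β B (c • g) := by
  unfold BoundaryCondition at *
  have h1 : ![(c • g) 1, (c • g) β] = c • ![g 1, g β] := by simp
  rw [h1, Matrix.mulVec_smul, hg]
  simp

theorem boundaryCondition_zero (α β : ℝ) (B : Matrix (Fin 2) (Fin 2) ℂ) :
    BoundaryCondition α β B 0 := by
  unfold BoundaryCondition
  have h1 : ![(0 : ℝ → ℂ) 1, (0 : ℝ → ℂ) β] = 0 := by simp
  rw [h1, Matrix.mulVec_zero]
  ext i
  fin_cases i <;> simp

/-- The functions in `L²(Ω)` with an absolutely continuous version satisfying the boundary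
condition given by `B`. -/
def boundaryDomain (α β : ℝ) (B : Matrix (Fin 2) (Fin 2) ℂ) : Submodule ℂ (L2Omega α β) where
  carrier := {f | ∃ g : ℝ → ℂ, IsAC α β g ∧ f =ᵐ[volume.restrict (Omega α β)] g ∧
    BoundaryCondition α β B g}
  zero_mem' := ⟨0, isAC_zero α β, Lp.coeFn_zero _ _ _, boundaryCondition_zero α β B⟩
  add_mem' := by
    rintro f f' ⟨g, hg, hf, hb⟩ ⟨g', hg', hf', hb'⟩
    exact ⟨g + g', hg.add hg', (Lp.coeFn_add f f').trans (hf.add hf'), hb.add hb'⟩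
  smul_mem' := by
    rintro c f ⟨g, hg, hf, hb⟩
    exact ⟨c • g, hg.const_smul c, (Lp.coeFn_smul c f).trans (hf.const_smul c), hb.const_smul c⟩

/-- The operator `P_B`: the restriction of `P` to `{f ∈ D(P) | B ρ₁(f) = ρ₂(f)}`. -/
def momentum (α β : ℝ) (B : Matrix (Fin 2) (Fin 2) ℂ) : L2Omega α β →ₗ.[ℂ] L2Omega α β :=
  (maxMomentum α β).domRestrict (boundaryDomain α β B)

/-- The parametrization of the unitary `2 × 2` matrices by `0 ≤ w ≤ 1` and real `θ, φ, ψ`. -/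
def boundaryMatrix (w θ φ ψ : ℝ) : Matrix (Fin 2) (Fin 2) ℂ :=
  !![(w : ℂ) * e φ, -((Real.sqrt (1 - w ^ 2) : ℝ) : ℂ) * e (θ - ψ);
     ((Real.sqrt (1 - w ^ 2) : ℝ) : ℂ) * e ψ, (w : ℂ) * e (θ - φ)]

/-! ### Generalized eigenfunctions -/

/-- The test functions `D_B`: smooth compactly supported functions on the line which, together
with all their derivatives, satisfy the boundary condition. -/
def testSpace (α β : ℝ) (B : Matrix (Fin 2) (Fin 2) ℂ) : Submodule ℂ (ℝ → ℂ) where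
  carrier := {η | ContDiff ℝ ∞ η ∧ HasCompactSupport η ∧
    ∀ k : ℕ, BoundaryCondition α β B (iteratedDeriv k η)}
  zero_mem' := by
    refine ⟨contDiff_const, HasCompactSupport.zero, fun k => ?_⟩
    have h : iteratedDeriv k (0 : ℝ → ℂ) = 0 := by
      funext x
      simp
    rw [h]
    exact boundaryCondition_zero α β B
  add_mem' := by
    rintro f g ⟨hf, hf', hf''⟩ ⟨hg, hg', hg''⟩
    refine ⟨hf.add hg, hf'.add hg', fun k => ?_⟩
    have h : iteratedDeriv k (f + g) = iteratedDeriv k f + iteratedDeriv k g := by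
      funext x
      exact iteratedDeriv_add (hf.of_le (by exact_mod_cast le_top)).contDiffAt
        (hg.of_le (by exact_mod_cast le_top)).contDiffAt
    rw [h]
    exact (hf'' k).add (hg'' k)
  smul_mem' := by
    rintro c f ⟨hf, hf', hf''⟩
    refine ⟨contDiff_const.smul hf, hf'.smul_left (f := fun _ => c), fun k => ?_⟩
    have h : iteratedDeriv k (c • f) = c • iteratedDeriv k f := by
      funext x
      exact iteratedDeriv_const_smul_field c f
    rw [h]
    exact (hf'' k).const_smul c

theorem deriv_mem_testSpace {α β : ℝ} {B : Matrix (Fin 2) (Fin 2) ℂ} {η : ℝ → ℂ}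
    (h : η ∈ testSpace α β B) : deriv η ∈ testSpace α β B := by
  obtain ⟨h1, h2, h3⟩ := h
  refine ⟨(contDiff_infty_iff_deriv.mp h1).2, h2.deriv, fun k => ?_⟩
  rw [← iteratedDeriv_succ']
  exact h3 (k + 1)

/-- The action `η ↦ (1 / 2πi) η'` of the momentum operator on test functions. -/
def testMomentum {α β : ℝ} {B : Matrix (Fin 2) (Fin 2) ℂ} (η : testSpace α β B) :
    testSpace α β B :=
  (2 * (Real.pi : ℂ) * Complex.I)⁻¹ • ⟨deriv (η : ℝ → ℂ), deriv_mem_testSpace η.2⟩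

/-- Continuity of an antilinear functional on `D_B(Ω)`, the space of restrictions to `Ω` of test
functions: on the test functions supported in `[-R, R]` it is bounded by a multiple of finitely
many of the seminorms `sup_Ω |η⁽ᵏ⁾|`.  In particular it only depends on the restriction of
the test function to `Ω`. -/
def IsDistribution {α β : ℝ} {B : Matrix (Fin 2) (Fin 2) ℂ}
    (T : testSpace α β B →ₛₗ[starRingEnd ℂ] ℂ) : Prop :=
  ∀ R : ℝ, ∃ (N : ℕ) (C : ℝ), ∀ (η : testSpace α β B) (M : ℝ),
    tsupport (η : ℝ → ℂ) ⊆ Icc (-R) R →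
    (∀ k ≤ N, ∀ x ∈ Omega α β, ‖iteratedDeriv k (η : ℝ → ℂ) x‖ ≤ M) →
    ‖T η‖ ≤ C * M

/-- `T` is a generalized eigenvector of `P_B` with generalized eigenvalue `lam`: a nonzero element
of the antidual `D_B'(Ω)` with `T(P η) = lam T(η)` for all test functions `η`. -/
def IsGeneralizedEigenvector {α β : ℝ} {B : Matrix (Fin 2) (Fin 2) ℂ} (lam : ℝ)
    (T : testSpace α β B →ₛₗ[starRingEnd ℂ] ℂ) : Prop :=
  IsDistribution T ∧ T ≠ 0 ∧ ∀ η, T (testMomentum η) = (lam : ℂ) * T η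

/-- `u` is a generalized eigenfunction of `P_B`: `u` is integrable on bounded subsets of `Ω` and the
functional `η ↦ ∫_Ω conj(η) u` is a generalized eigenvector. -/
def IsGeneralizedEigenfunction (α β : ℝ) (B : Matrix (Fin 2) (Fin 2) ℂ) (lam : ℝ)
    (u : ℝ → ℂ) : Prop :=
  (∀ R : ℝ, IntegrableOn u (Omega α β ∩ Icc (-R) R)) ∧
  ∃ T : testSpace α β B →ₛₗ[starRingEnd ℂ] ℂ,
    (∀ η : testSpace α β B, T η = ∫ x in Omega α β, conj ((η : ℝ → ℂ) x) * u x) ∧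
    IsGeneralizedEigenvector lam T

/-- `(a χ₋ + b χ₀ + c χ₊) e_lam`, where `χ₋, χ₀, χ₊` are the indicator functions of
`(-∞, 0)`, `(1, α)`, `(β, ∞)` and `e_lam(x) = e(lam x)`. -/
def planeWave (α β : ℝ) (a b c : ℂ) (lam : ℝ) (x : ℝ) : ℂ :=
  (a * (Iio (0 : ℝ)).indicator 1 x + b * (Ioo 1 α).indicator 1 x + c * (Ioi β).indicator 1 x) *
    e (lam * x)

/-- The bound state energies `ψ/(α-1) + ℤ/(α-1)`. -/
def boundStates (α ψ : ℝ) : Set ℝ := Set.range fun n : ℤ => ψ / (α - 1) + n / (α - 1)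

/-- The sum of Lebesgue measure and of the point masses `1/(α-1)` at the bound state energies. -/
def spectralMeasure (α ψ : ℝ) : Measure ℝ :=
  volume + ENNReal.ofReal (1 / (α - 1)) •
    Measure.sum fun n : ℤ => Measure.dirac (ψ / (α - 1) + n / (α - 1))

end TwoIntervals

end

open TwoIntervals

noncomputable section

namespace TwoIntervals

/-! ### Symmetric and self-adjoint operators. -/

section Operators

variable {H : Type*} [NormedAddCommGroup H] [InnerProductSpace ℂ H]

/-! For `w = 0` the boundary condition decouples into `f(0) = -e(θ-ψ) f(β)` and `f(α) = e(ψ) f(1)`.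
The first relation glues the two half-lines to a full line, where the momentum operator is
diagonalized by the Fourier transform; this gives the Lebesgue part of the spectrum. The second is a
quasi-periodic condition on `(1, α)`, diagonalized by a Fourier series with frequencies in `Λ`; this
gives the atoms. Because `Λ` is Lebesgue null, the two parts are mutually singular and fit side by
side into one scalar space `L²(ν)`, and so the multiplicity is one although the eigenvalues are
embedded.

The map `expansion` collects both kinds of coefficients. Plancherel and Parseval make it isometric
(`eLpNorm_expansion`), and `surjective_expansionIsometry` makes it unitary. That it diagonalizes
`P_B` is proved from one side only: if `ξ U f` is square integrable, the inversion integral of `U f`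
converges absolutely and is an absolutely continuous version of `f` with the right derivative and
boundary values (`IsWaveTransform.exists_mem_domain`). Hence `P_B` contains the multiplication
operator. It is also symmetric (`isFormalAdjoint_momentum`), and multiplication by the variable has
no proper symmetric extension (`isSpectralRepresentation_of_isFormalAdjoint`). Self-adjointness,
spectrum and eigenspaces are then read off from the multiplication operator.

The generalized eigenfunctions are treated independently of the expansion. Integration by parts
against a plane wave leaves two boundary terms, weighted by the values of the test function at `β`
and at `1` (`planeWaveFunctional_testMomentum_of_boundary`). These two values can be prescribed
freely, so each term must vanish; this is the condition on `(a, b, c)` and `λ`. -/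

theorem _root_.LinearPMap.IsFormalAdjoint.eq_zero_of_apply_eq_I_smul {A : H →ₗ.[ℂ] H}
    (hs : A.IsFormalAdjoint A) (x : A.domain) (h : A x = Complex.I • (x : H)) : (x : H) = 0 := by
  have h1 := hs x x
  rw [h, inner_smul_left, inner_smul_right, Complex.conj_I] at h1
  have h2 : Complex.I * inner ℂ (x : H) (x : H) = 0 := by linear_combination -(1 / 2 : ℂ) * h1
  simpa [Complex.I_ne_zero] using h2

/-- The basic criterion for self-adjointness. Density of the domain need not be assumed: it follows
from symmetry and surjectivity of `A - i`. -/
theorem isSelfAdjoint_of_isFormalAdjoint_of_surjective [CompleteSpace H] {A : H →ₗ.[ℂ] H}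
    (hs : A.IsFormalAdjoint A) (hp : ∀ x : H, ∃ y : A.domain, A y + Complex.I • (y : H) = x)
    (hm : ∀ x : H, ∃ y : A.domain, A y - Complex.I • (y : H) = x) : IsSelfAdjoint A := by
  have hd : Dense (A.domain : Set H) := by
    rw [Submodule.dense_iff_topologicalClosure_eq_top, Submodule.topologicalClosure_eq_top_iff,
      Submodule.eq_bot_iff]
    intro v hv
    obtain ⟨y, hy⟩ := hm v
    have h1 : inner ℂ (y : H) v = 0 := hv _ y.2
    have h2 := hs y y
    -- With `v = (A - i) y`, orthogonality of `v` to `y` says `⟨A y, y⟩ = i ‖y‖²`. The left side is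
    -- real by symmetry, so `y = 0`.
    rw [← hy, inner_sub_right, inner_smul_right, ← h2] at h1
    have h3 : inner ℂ (A y) (y : H) = Complex.I * inner ℂ (y : H) (y : H) := by
      linear_combination h1
    have h4 := congrArg Complex.im h3
    have h5 : (inner ℂ (A y) (y : H)).im = 0 := by
      have h6 := inner_conj_symm (𝕜 := ℂ) (A y) (y : H)
      rw [← h2] at h6
      exact Complex.conj_eq_iff_im.mp h6
    rw [h5, inner_self_eq_norm_sq_to_K] at h4
    have h7 : ‖(y : H)‖ = 0 := by
      have : (0 : ℝ) = ‖(y : H)‖ ^ 2 := by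
        rw [h4]
        simp [← Complex.ofReal_pow]
      exact pow_eq_zero_iff two_ne_zero |>.mp this.symm
    have h8 : y = 0 := by
      ext
      simpa using h7
    rw [← hy, h8]
    simp
  have hle : A ≤ A.adjoint := hs.le_adjoint hd
  rw [LinearPMap.isSelfAdjoint_def]
  symm
  refine LinearPMap.eq_of_le_of_domain_eq hle (le_antisymm hle.1 ?_)
  intro y hy
  -- Choose `x` in the domain of `A` with `(A - i) x = (A* - i) y`. Then `y - x` is orthogonal to
  -- the range of `A + i`, which is the whole space, so `y = x`.
  obtain ⟨x, hx⟩ := hm (A.adjoint ⟨y, hy⟩ - Complex.I • y)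
  have hx' : A x = A.adjoint ⟨x, hle.1 x.2⟩ := hle.2 rfl
  have hdiff : ∀ z : A.domain, inner ℂ (y - (x : H)) (A z + Complex.I • (z : H)) = 0 := by
    intro z
    have h1 := LinearPMap.adjoint_isFormalAdjoint hd ⟨y, hy⟩ z
    have h2 := hs x z
    have h3 := congrArg (fun v => inner ℂ v (z : H)) hx
    simp only [inner_sub_left, inner_smul_left, Complex.conj_I] at h3
    rw [inner_sub_left, inner_add_right, inner_add_right, inner_smul_right, inner_smul_right,
      ← h1, ← h2]
    linear_combination -h3
  obtain ⟨z, hz⟩ := hp (y - x)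
  have h0 := hdiff z
  rw [hz, inner_self_eq_zero, sub_eq_zero] at h0
  rw [h0]
  exact x.2

end Operators

/-! ### Bounded multiplication operators and the resolvent of multiplication by the variable. -/

section Multiplication

variable {ν : Measure ℝ}

/-- Multiplication by a bounded measurable function on `L²(ν)`. -/
def mulLp (ν : Measure ℝ) (m : ℝ → ℂ) (hm : Measurable m) (C : ℝ) (hC : ∀ ξ, ‖m ξ‖ ≤ C) :
    Lp ℂ 2 ν →L[ℂ] Lp ℂ 2 ν :=
  have hmem : ∀ h : Lp ℂ 2 ν, MemLp (fun ξ => m ξ * h ξ) 2 ν := fun h =>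
    (Lp.memLp h).of_le_mul (c := C) (hm.aestronglyMeasurable.mul (Lp.aestronglyMeasurable h))
      (ae_of_all _ fun ξ => by
        rw [norm_mul]; exact mul_le_mul_of_nonneg_right (hC ξ) (norm_nonneg _))
  LinearMap.mkContinuous
    { toFun := fun h => (hmem h).toLp _
      map_add' := fun g h => by
        refine Lp.ext ?_
        filter_upwards [(hmem (g + h)).coeFn_toLp, (hmem g).coeFn_toLp, (hmem h).coeFn_toLp,
          Lp.coeFn_add g h, Lp.coeFn_add ((hmem g).toLp _) ((hmem h).toLp _)] with ξ h1 h2 h3 h4 h5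
        rw [h1, h5, Pi.add_apply, h2, h3, h4, Pi.add_apply, mul_add]
      map_smul' := fun c h => by
        refine Lp.ext ?_
        filter_upwards [(hmem (c • h)).coeFn_toLp, (hmem h).coeFn_toLp,
          Lp.coeFn_smul c h, Lp.coeFn_smul c ((hmem h).toLp _)] with ξ h1 h2 h3 h4
        rw [h1, RingHom.id_apply, h4, Pi.smul_apply, h2, h3, Pi.smul_apply, smul_eq_mul,
          smul_eq_mul]
        ring }
    C (fun h => Lp.norm_le_mul_norm_of_ae_le_mul (by
        filter_upwards [(hmem h).coeFn_toLp] with ξ h1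
        change ‖((hmem h).toLp _ : ℝ → ℂ) ξ‖ ≤ _
        rw [h1, norm_mul]
        exact mul_le_mul_of_nonneg_right (hC ξ) (norm_nonneg _)))

theorem coeFn_mulLp (m : ℝ → ℂ) (hm : Measurable m) (C : ℝ) (hC : ∀ ξ, ‖m ξ‖ ≤ C)
    (h : Lp ℂ 2 ν) : mulLp ν m hm C hC h =ᵐ[ν] fun ξ => m ξ * h ξ := by
  exact MemLp.coeFn_toLp ((Lp.memLp h).of_le_mul (c := C)
    (hm.aestronglyMeasurable.mul (Lp.aestronglyMeasurable h))
    (ae_of_all _ fun ξ => by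
      rw [Pi.mul_apply, norm_mul]; exact mul_le_mul_of_nonneg_right (hC ξ) (norm_nonneg _)))

theorem norm_inv_sub_le {z : ℂ} (hz : z.im ≠ 0) (ξ : ℝ) : ‖((ξ : ℂ) - z)⁻¹‖ ≤ |z.im|⁻¹ := by
  rw [norm_inv]
  refine inv_anti₀ (abs_pos.mpr hz) ?_
  have := Complex.abs_im_le_norm ((ξ : ℂ) - z)
  simpa using this

theorem ofReal_sub_ne_zero {z : ℂ} (hz : z.im ≠ 0) (ξ : ℝ) : (ξ : ℂ) - z ≠ 0 := by
  intro h
  have := congrArg Complex.im h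
  simp at this
  exact hz this

/-- Multiplication by `1 / (ξ - z)` on `L²(ν)`. -/
def resolventLp (ν : Measure ℝ) (z : ℂ) (hz : z.im ≠ 0) : Lp ℂ 2 ν →L[ℂ] Lp ℂ 2 ν :=
  mulLp ν (fun ξ => ((ξ : ℂ) - z)⁻¹) (by fun_prop) _ (norm_inv_sub_le hz)

theorem coeFn_resolventLp (z : ℂ) (hz : z.im ≠ 0) (h : Lp ℂ 2 ν) :
    resolventLp ν z hz h =ᵐ[ν] fun ξ => ((ξ : ℂ) - z)⁻¹ * h ξ :=
  coeFn_mulLp _ _ _ _ h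

/-- From `ξ / (ξ - z) = 1 + z / (ξ - z)`: the resolvent maps into the maximal domain of
multiplication by `ξ`. -/
theorem ofReal_mul_resolventLp (z : ℂ) (hz : z.im ≠ 0) (h : Lp ℂ 2 ν) :
    (fun ξ : ℝ => (ξ : ℂ) * resolventLp ν z hz h ξ) =ᵐ[ν] (h + z • resolventLp ν z hz h : Lp ℂ 2 ν) := by
  filter_upwards [coeFn_resolventLp z hz h, Lp.coeFn_add h (z • resolventLp ν z hz h),
    Lp.coeFn_smul z (resolventLp ν z hz h)] with ξ h1 h2 h3
  rw [h2, Pi.add_apply, h3, Pi.smul_apply, h1, smul_eq_mul]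
  field_simp [ofReal_sub_ne_zero hz ξ]
  ring

end Multiplication

/-! ### Consequences of a spectral representation. -/

section Representation

variable {H : Type*} [NormedAddCommGroup H] [InnerProductSpace ℂ H]
  {ν : Measure ℝ} {A : H →ₗ.[ℂ] H} {U : H ≃ₗᵢ[ℂ] Lp ℂ 2 ν}

/-- A symmetric operator which contains the operator of multiplication by the variable is equal
to it. -/
theorem isSpectralRepresentation_of_isFormalAdjoint (hs : A.IsFormalAdjoint A)
    (hA : ∀ f : H, MemLp (fun ξ : ℝ => (ξ : ℂ) * U f ξ) 2 ν →
      ∃ hf : f ∈ A.domain, U (A ⟨f, hf⟩) =ᵐ[ν] fun ξ : ℝ => (ξ : ℂ) * U f ξ) :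
    IsSpectralRepresentation A ν U := by
  -- Let `r` be the multiplication resolvent at `i` applied to `U (A - i) f`. By hypothesis `U⁻¹ r`
  -- lies in the domain of `A`, and `A - i` takes the same value there as at `f`. The difference
  -- would be an eigenvector for `i`, which a symmetric operator does not have, so `f = U⁻¹ r`.
  have key : ∀ f : A.domain, MemLp (fun ξ : ℝ => (ξ : ℂ) * U (f : H) ξ) 2 ν := by
    intro f
    have hI : Complex.I.im ≠ 0 := by simp
    set g : Lp ℂ 2 ν := U (A f - Complex.I • (f : H)) with hg
    set r := resolventLp ν Complex.I hI g
    have hr := ofReal_mul_resolventLp Complex.I hI g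
    have hmem : MemLp (fun ξ : ℝ => (ξ : ℂ) * U (U.symm r) ξ) 2 ν := by
      rw [U.apply_symm_apply]
      exact (Lp.memLp _).ae_eq hr.symm
    obtain ⟨hf', hf''⟩ := hA _ hmem
    have h1 : U (A ⟨U.symm r, hf'⟩) = g + Complex.I • r := by
      refine Lp.ext (hf''.trans ?_)
      rw [U.apply_symm_apply]
      exact hr
    have h2 : A ⟨U.symm r, hf'⟩ = A f - Complex.I • (f : H) + Complex.I • U.symm r := by
      apply U.injective
      rw [h1, map_add, map_smul, U.apply_symm_apply]
    have h3 := hs.eq_zero_of_apply_eq_I_smul (f - ⟨U.symm r, hf'⟩) (by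
      rw [LinearPMap.map_sub, h2]
      simp only [AddSubgroupClass.coe_sub, smul_sub]
      abel)
    have h4 : (f : H) = U.symm r := by
      simpa [sub_eq_zero] using h3
    rw [h4]
    exact hmem
  refine ⟨fun f => ⟨fun hf => key ⟨f, hf⟩, fun hf => (hA f hf).1⟩, fun f => ?_⟩
  exact (hA _ (key f)).2

theorem IsSpectralRepresentation.isFormalAdjoint (h : IsSpectralRepresentation A ν U) :
    A.IsFormalAdjoint A := by
  intro f g
  rw [← U.inner_map_map, ← U.inner_map_map (f : H), L2.inner_def, L2.inner_def]
  refine integral_congr_ae ?_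
  filter_upwards [h.2 f, h.2 g] with ξ h1 h2
  rw [h1, h2]
  simp only [RCLike.inner_apply, map_mul, Complex.conj_ofReal]
  ring

theorem IsSpectralRepresentation.apply_sub_smul (h : IsSpectralRepresentation A ν U) (z : ℂ)
    (y : A.domain) : U (A y - z • (y : H)) =ᵐ[ν] fun ξ => ((ξ : ℂ) - z) * U (y : H) ξ := by
  rw [map_sub, map_smul]
  filter_upwards [h.2 y, Lp.coeFn_sub (U (A y)) (z • U (y : H)), Lp.coeFn_smul z (U (y : H))]
    with ξ h1 h2 h3
  rw [h2, Pi.sub_apply, h1, h3, Pi.smul_apply, smul_eq_mul]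
  ring

theorem IsSpectralRepresentation.isResolventPoint (h : IsSpectralRepresentation A ν U) {z : ℂ}
    (hz : z.im ≠ 0) : IsResolventPoint A z := by
  have hR : ∀ x : H, U.symm (resolventLp ν z hz (U x)) ∈ A.domain := by
    intro x
    rw [h.1, U.apply_symm_apply]
    exact (Lp.memLp _).ae_eq (ofReal_mul_resolventLp z hz _).symm
  refine ⟨(U.symm.toContinuousLinearEquiv : Lp ℂ 2 ν →L[ℂ] H).comp
    ((resolventLp ν z hz).comp (U.toContinuousLinearEquiv : H →L[ℂ] Lp ℂ 2 ν)),
    fun x => ⟨hR x, ?_⟩, fun y => ?_⟩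
  · apply U.injective
    refine Lp.ext ((h.apply_sub_smul z ⟨_, hR x⟩).trans ?_)
    filter_upwards [coeFn_resolventLp z hz (U x)] with ξ h1
    rw [U.apply_symm_apply, h1, mul_inv_cancel_left₀ (ofReal_sub_ne_zero hz ξ)]
  · change U.symm (resolventLp ν z hz (U (A y - z • (y : H)))) = _
    rw [LinearIsometryEquiv.symm_apply_eq]
    refine Lp.ext ?_
    filter_upwards [coeFn_resolventLp z hz (U (A y - z • (y : H))), h.apply_sub_smul z y]
      with ξ h1 h2
    rw [h1, h2, inv_mul_cancel_left₀ (ofReal_sub_ne_zero hz ξ)]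

theorem IsSpectralRepresentation.isSelfAdjoint [CompleteSpace H]
    (h : IsSpectralRepresentation A ν U) : IsSelfAdjoint A := by
  refine isSelfAdjoint_of_isFormalAdjoint_of_surjective h.isFormalAdjoint (fun x => ?_)
    (fun x => ?_)
  · obtain ⟨R, hR, -⟩ := h.isResolventPoint (z := -Complex.I) (by simp)
    obtain ⟨hx, hx'⟩ := hR x
    exact ⟨⟨R x, hx⟩, by simpa using hx'⟩
  · obtain ⟨R, hR, -⟩ := h.isResolventPoint (z := Complex.I) (by simp)
    obtain ⟨hx, hx'⟩ := hR x
    exact ⟨⟨R x, hx⟩, hx'⟩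

/-- Indicators of short intervals at `t` are approximate eigenvectors: `A - t` shrinks them by the
length of the interval, which no bounded inverse permits. Local finiteness of `ν` puts them in `L²`.
-/
theorem IsSpectralRepresentation.mem_opSpectrum_of_real (h : IsSpectralRepresentation A ν U)
    [IsLocallyFiniteMeasure ν] {t : ℝ} (hpos : ∀ ε > 0, ν (Ioo t (t + ε)) ≠ 0) :
    (t : ℂ) ∈ opSpectrum A := by
  rintro ⟨R, -, hR⟩
  -- Chosen so that `‖R‖ ε < 1`, contradicting `‖k‖ ≤ ‖R‖ ε ‖k‖`.
  set ε : ℝ := (‖R‖ + 1)⁻¹ with hε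
  have hRpos : 0 < ‖R‖ + 1 := by positivity
  have hε0 : 0 < ε := by positivity
  have hfin : ν (Ioo t (t + ε)) ≠ ⊤ :=
    ((measure_mono Ioo_subset_Icc_self).trans_lt isCompact_Icc.measure_lt_top).ne
  set k : Lp ℂ 2 ν := indicatorConstLp 2 measurableSet_Ioo hfin (1 : ℂ) with hk
  have hkcoe : k =ᵐ[ν] (Ioo t (t + ε)).indicator fun _ => (1 : ℂ) := indicatorConstLp_coeFn
  have hy : U.symm k ∈ A.domain := by
    rw [h.1, U.apply_symm_apply]
    refine (Lp.memLp k).of_le_mul (c := |t| + ε) ?_ ?_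
    · exact (Complex.measurable_ofReal.aestronglyMeasurable).mul (Lp.aestronglyMeasurable k)
    · filter_upwards [hkcoe] with ξ h1
      rw [h1]
      by_cases hξ : ξ ∈ Ioo t (t + ε)
      · simp only [indicator_of_mem hξ, mul_one, norm_one, Complex.norm_real, Real.norm_eq_abs]
        rw [abs_le]
        constructor <;> [linarith [hξ.1, neg_abs_le t]; linarith [hξ.2, le_abs_self t]]
      · simp [indicator_of_notMem hξ]
  have h1 : ‖U (A ⟨U.symm k, hy⟩ - (t : ℂ) • U.symm k)‖ ≤ ε * ‖k‖ := by
    refine Lp.norm_le_mul_norm_of_ae_le_mul ?_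
    filter_upwards [h.apply_sub_smul t ⟨U.symm k, hy⟩, hkcoe] with ξ h1 h2
    rw [h1, U.apply_symm_apply, h2, norm_mul]
    by_cases hξ : ξ ∈ Ioo t (t + ε)
    · simp only [indicator_of_mem hξ, mul_one, norm_one, ← Complex.ofReal_sub, Complex.norm_real,
        Real.norm_eq_abs]
      rw [abs_le]
      constructor <;> linarith [hξ.1, hξ.2]
    · simp [indicator_of_notMem hξ]
  have h2 : ‖k‖ ≤ ‖R‖ * (ε * ‖k‖) := by
    calc ‖k‖ = ‖R (A ⟨U.symm k, hy⟩ - (t : ℂ) • U.symm k)‖ := by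
          rw [hR ⟨U.symm k, hy⟩, LinearIsometryEquiv.norm_map]
      _ ≤ ‖R‖ * ‖A ⟨U.symm k, hy⟩ - (t : ℂ) • U.symm k‖ := R.le_opNorm _
      _ ≤ ‖R‖ * (ε * ‖k‖) := by
          gcongr
          rw [← U.norm_map]
          exact h1
  have hk0 : 0 < ‖k‖ := by
    rw [hk, norm_indicatorConstLp two_ne_zero ENNReal.ofNat_ne_top, norm_one, one_mul]
    exact Real.rpow_pos_of_pos (ENNReal.toReal_pos (hpos ε hε0) hfin) _
  have h3 : ‖R‖ * ε < 1 := by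
    rw [hε, ← div_eq_mul_inv, div_lt_one hRpos]
    linarith
  nlinarith

theorem IsSpectralRepresentation.opSpectrum_eq (h : IsSpectralRepresentation A ν U)
    [IsLocallyFiniteMeasure ν] [ν.IsOpenPosMeasure] :
    opSpectrum A = Set.range (fun t : ℝ => (t : ℂ)) := by
  ext z
  constructor
  · intro hz
    by_contra hz'
    refine hz (h.isResolventPoint fun him => hz' ⟨z.re, ?_⟩)
    apply Complex.ext <;> simp [him]
  · rintro ⟨t, rfl⟩
    exact h.mem_opSpectrum_of_real fun ε hε => (isOpen_Ioo.measure_pos ν ⟨t + ε / 2, by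
      constructor <;> linarith⟩).ne'

/-- The eigenspaces of a multiplication operator. -/
theorem IsSpectralRepresentation.mem_opEigenspace_iff (h : IsSpectralRepresentation A ν U) {z : ℂ}
    {f : H} : f ∈ opEigenspace A z ↔ ∀ᵐ ξ : ℝ ∂ν, (ξ : ℂ) ≠ z → U f ξ = 0 := by
  constructor
  · rintro ⟨hf, hf'⟩
    have h1 := h.apply_sub_smul z ⟨f, hf⟩
    rw [hf', sub_self, map_zero] at h1
    filter_upwards [h1, Lp.coeFn_zero ℂ 2 ν] with ξ h2 h3 hξ
    rw [h3, Pi.zero_apply] at h2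
    exact (mul_eq_zero.mp h2.symm).resolve_left (sub_ne_zero.mpr hξ)
  · intro h0
    have h1 : (fun ξ : ℝ => (ξ : ℂ) * U f ξ) =ᵐ[ν] (z • U f : Lp ℂ 2 ν) := by
      filter_upwards [h0, Lp.coeFn_smul z (U f)] with ξ h2 h3
      rw [h3, Pi.smul_apply, smul_eq_mul]
      by_cases hξ : (ξ : ℂ) = z
      · rw [hξ]
      · rw [h2 hξ, mul_zero, mul_zero]
    have hf : f ∈ A.domain := (h.1 f).mpr ((Lp.memLp _).ae_eq h1.symm)
    refine ⟨hf, U.injective ?_⟩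
    rw [map_smul]
    exact Lp.ext ((h.2 ⟨f, hf⟩).trans h1)

end Representation

/-! ### The exponential -/

theorem e_add (x y : ℝ) : e (x + y) = e x * e y := by
  rw [e, e, e, ← Complex.exp_add]
  push_cast
  ring_nf

theorem e_zero : e 0 = 1 := by simp [e]

theorem e_eq_expI (x : ℝ) : e x = Complex.exp ((2 * Real.pi * x : ℝ) * Complex.I) := by
  rw [e]
  push_cast
  ring_nf

theorem norm_e (x : ℝ) : ‖e x‖ = 1 := by
  rw [e_eq_expI, Complex.norm_exp_ofReal_mul_I]

theorem e_ne_zero (x : ℝ) : e x ≠ 0 := Complex.exp_ne_zero _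

theorem conj_e (x : ℝ) : conj (e x) = e (-x) := by
  rw [e_eq_expI, e_eq_expI, ← Complex.exp_conj, map_mul, Complex.conj_ofReal, Complex.conj_I]
  push_cast
  ring_nf

theorem e_neg_mul_e (x : ℝ) : e (-x) * e x = 1 := by rw [← e_add, neg_add_cancel, e_zero]

theorem e_mul_e_neg (x : ℝ) : e x * e (-x) = 1 := by rw [← e_add, add_neg_cancel, e_zero]

theorem e_eq_one_iff (x : ℝ) : e x = 1 ↔ ∃ n : ℤ, x = n := by
  rw [e, Complex.exp_eq_one_iff]
  refine exists_congr fun n => ?_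
  rw [mul_comm (n : ℂ), mul_right_inj' Complex.two_pi_I_ne_zero]
  exact_mod_cast Iff.rfl

@[fun_prop]
theorem continuous_e : Continuous e := by
  unfold e
  fun_prop

theorem hasDerivAt_e_mul (lam x : ℝ) :
    HasDerivAt (fun x => e (lam * x)) (2 * Real.pi * Complex.I * lam * e (lam * x)) x := by
  have h1 : HasDerivAt (fun x : ℝ => ((lam * x : ℝ) : ℂ)) (lam : ℂ) x := by
    simpa using ((hasDerivAt_id x).const_mul lam).ofReal_comp
  have h2 := (h1.const_mul (2 * Real.pi * Complex.I)).cexp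
  convert! h2 using 1
  simp only [e]
  ring

/-! ### The spectral measure -/

theorem countable_boundStates (α ψ : ℝ) : (boundStates α ψ).Countable := countable_range _

theorem measurableSet_boundStates (α ψ : ℝ) : MeasurableSet (boundStates α ψ) :=
  (countable_boundStates α ψ).measurableSet

theorem volume_boundStates (α ψ : ℝ) : volume (boundStates α ψ) = 0 :=
  (countable_boundStates α ψ).measure_zero _

theorem ae_notMem_boundStates (α ψ : ℝ) : ∀ᵐ ξ : ℝ, ξ ∉ boundStates α ψ :=
  measure_eq_zero_iff_ae_notMem.mp (volume_boundStates α ψ)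

/-- The right side is the condition `g(α) = e(ψ) g(1)` for `g = e_lam`; `Λ` enters the proofs mainly
through this form. -/
theorem mem_boundStates_iff {α ψ : ℝ} (hα : 1 < α) (lam : ℝ) :
    lam ∈ boundStates α ψ ↔ e (lam * (α - 1)) = e ψ := by
  have h0 : α - 1 ≠ 0 := by linarith
  have h1 : e (lam * (α - 1)) = e ψ ↔ e (lam * (α - 1) - ψ) = 1 := by
    constructor
    · intro h
      rw [sub_eq_add_neg, e_add, h, e_mul_e_neg]
    · intro h
      have := e_add (lam * (α - 1) - ψ) ψ
      rw [h, one_mul, sub_add_cancel] at this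
      exact this
  rw [h1, e_eq_one_iff]
  refine exists_congr fun n => ?_
  change ψ / (α - 1) + (n : ℝ) / (α - 1) = lam ↔ _
  rw [← add_div, div_eq_iff h0, sub_eq_iff_eq_add, add_comm, eq_comm]

theorem boundState_injective {α : ℝ} (hα : 1 < α) (ψ : ℝ) :
    Function.Injective fun n : ℤ => ψ / (α - 1) + (n : ℝ) / (α - 1) := by
  intro m n h
  have h0 : α - 1 ≠ 0 := by linarith
  have h1 : (m : ℝ) / (α - 1) = n / (α - 1) := by simpa using h
  rw [div_left_inj' h0] at h1
  exact_mod_cast h1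

theorem ofReal_weight_ne_zero {α : ℝ} (hα : 1 < α) : ENNReal.ofReal (1 / (α - 1)) ≠ 0 := by
  rw [Ne, ENNReal.ofReal_eq_zero, not_le]
  exact one_div_pos.mpr (by linarith)

/-- Each point of `Λ` carries positive mass, so "almost everywhere" means everywhere on `Λ`. In
particular elements of `L²(ν)` have well-defined values on `Λ`. -/
theorem ae_spectralMeasure_iff {α : ℝ} (hα : 1 < α) (ψ : ℝ) {p : ℝ → Prop} :
    (∀ᵐ ξ ∂(spectralMeasure α ψ), p ξ) ↔
      (∀ᵐ ξ : ℝ, p ξ) ∧ ∀ ξ ∈ boundStates α ψ, p ξ := by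
  rw [spectralMeasure, ae_add_measure_iff,
    Measure.ae_ennreal_smul_measure_iff (ofReal_weight_ne_zero hα), Measure.ae_sum_iff]
  simp [boundStates, ae_dirac_eq]

theorem lintegral_spectralMeasure (α ψ : ℝ) {f : ℝ → ENNReal} :
    ∫⁻ ξ, f ξ ∂(spectralMeasure α ψ) = (∫⁻ ξ, f ξ) +
      ENNReal.ofReal (1 / (α - 1)) * ∑' n : ℤ, f (ψ / (α - 1) + n / (α - 1)) := by
  rw [spectralMeasure, lintegral_add_measure, lintegral_smul_measure, lintegral_sum_measure]
  simp [lintegral_dirac]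

theorem volume_le_spectralMeasure (α ψ : ℝ) : volume ≤ spectralMeasure α ψ :=
  Measure.le_add_right le_rfl

instance (α ψ : ℝ) : (spectralMeasure α ψ).IsOpenPosMeasure :=
  (Measure.absolutelyContinuous_of_le (volume_le_spectralMeasure α ψ)).isOpenPosMeasure

/-- The function `1 / (1 + ξ²)` is integrable for the spectral measure. -/
theorem integrable_inv_one_add_sq_spectralMeasure {α : ℝ} (hα : 1 < α) (ψ : ℝ) :
    Integrable (fun ξ : ℝ => (1 + ξ ^ 2)⁻¹) (spectralMeasure α ψ) := by
  refine ⟨by fun_prop, ?_⟩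
  have h0 : 0 < α - 1 := by linarith
  have hsum : Summable fun n : ℤ => (1 + (ψ / (α - 1) + (n : ℝ) / (α - 1)) ^ 2)⁻¹ := by
    have h1 := ((Real.summable_one_div_int_add_rpow ψ 2).mpr one_lt_two).mul_left ((α - 1) ^ 2)
    -- The comparison series has terms `(α-1)² / |n+ψ|²`. It dominates except possibly at the one
    -- `n` with `n + ψ = 0`, where division by zero gives `0`.
    refine Summable.of_norm_bounded_eventually h1 ?_
    have h2 : {n : ℤ | (n : ℝ) + ψ = 0}.Finite :=
      Set.Subsingleton.finite fun m (hm : (m : ℝ) + ψ = 0) n (hn : (n : ℝ) + ψ = 0) => by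
        have h3 : (m : ℝ) + ψ = n + ψ := hm.trans hn.symm
        simpa using h3
    filter_upwards [h2.compl_mem_cofinite] with n hn
    have hn' : 0 < ((n : ℝ) + ψ) ^ 2 := by
      have : (n : ℝ) + ψ ≠ 0 := hn
      positivity
    rw [Real.norm_of_nonneg (by positivity), Real.rpow_two, sq_abs, mul_one_div,
      ← inv_div (((n : ℝ) + ψ) ^ 2), ← add_div, div_pow, add_comm ψ]
    exact inv_anti₀ (div_pos hn' (by positivity)) (by linarith)
  rw [HasFiniteIntegral, lintegral_spectralMeasure]
  refine ENNReal.add_lt_top.mpr ⟨integrable_inv_one_add_sq.2, ?_⟩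
  refine ENNReal.mul_lt_top ENNReal.ofReal_lt_top ?_
  have h1 : ∀ n : ℤ, ‖(1 + (ψ / (α - 1) + (n : ℝ) / (α - 1)) ^ 2)⁻¹‖ₑ =
      ENNReal.ofReal ((1 + (ψ / (α - 1) + (n : ℝ) / (α - 1)) ^ 2)⁻¹) := fun n =>
    Real.enorm_of_nonneg (by positivity)
  simp_rw [h1]
  rw [← ENNReal.ofReal_tsum_of_nonneg (fun n => by positivity) hsum]
  exact ENNReal.ofReal_lt_top

/-- By Markov's inequality the superlevel sets of the integrable function `1 / (1 + ξ²)` have finite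
measure, and by continuity they can be taken to be neighbourhoods of any given point. -/
theorem isLocallyFiniteMeasure_spectralMeasure {α : ℝ} (hα : 1 < α) (ψ : ℝ) :
    IsLocallyFiniteMeasure (spectralMeasure α ψ) := by
  refine ⟨fun x => ⟨{ξ | (1 + x ^ 2)⁻¹ / 2 ≤ ‖(1 + ξ ^ 2)⁻¹‖}, ?_,
    (integrable_inv_one_add_sq_spectralMeasure hα ψ).measure_norm_ge_lt_top (by positivity)⟩⟩
  have h1 : ContinuousAt (fun ξ : ℝ => ‖(1 + ξ ^ 2)⁻¹‖) x := by
    exact (ContinuousAt.inv₀ (f := fun ξ : ℝ => 1 + ξ ^ 2) (by fun_prop) (by positivity)).norm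
  refine h1.preimage_mem_nhds (Ici_mem_nhds ?_)
  rw [Real.norm_of_nonneg (by positivity)]
  have : 0 < (1 + x ^ 2)⁻¹ := by positivity
  linarith

theorem sigmaFinite_spectralMeasure {α : ℝ} (hα : 1 < α) (ψ : ℝ) :
    SigmaFinite (spectralMeasure α ψ) := by
  have := isLocallyFiniteMeasure_spectralMeasure hα ψ
  infer_instance

theorem spectralMeasure_singleton {α ψ : ℝ} (hα : 1 < α) {lam : ℝ} (hl : lam ∈ boundStates α ψ) :
    spectralMeasure α ψ {lam} = ENNReal.ofReal (1 / (α - 1)) := by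
  obtain ⟨m, rfl⟩ := hl
  rw [← lintegral_indicator_one (measurableSet_singleton _), lintegral_spectralMeasure,
    lintegral_indicator_one (measurableSet_singleton _), Real.volume_singleton, zero_add,
    tsum_eq_single m]
  · simp
  · intro n hn
    rw [indicator_of_notMem]
    exact fun h => hn (boundState_injective hα ψ h)

/-- The Plancherel transform is given by the Fourier integral on `L¹ ∩ L²`. -/
theorem coeFn_fourier_toLp {f : ℝ → ℂ} (hf : MemLp f 2) (hf1 : Integrable f) :
    (FourierTransform.fourier (hf.toLp f) : Lp ℂ 2 (volume : Measure ℝ)) =ᵐ[volume]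
      FourierTransform.fourier f := by
  -- Both sides are tested against a smooth compactly supported `g`. On either side the Fourier
  -- transform can be moved to `g`: on the left because the `L²` transform agrees with that of
  -- tempered distributions, on the right by Fubini for integrable functions.
  refine ae_eq_of_integral_contDiff_smul_eq
    ((Lp.memLp (FourierTransform.fourier (hf.toLp f))).locallyIntegrable (by norm_num)) ?_ ?_
  · have : Continuous (FourierTransform.fourier f) :=
      VectorFourier.fourierIntegral_continuous Real.continuous_fourierChar
        (by fun_prop) hf1
    exact this.locallyIntegrable
  intro g hg hgc
  let gc : ℝ → ℂ := fun x => (g x : ℂ)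
  have hgc1 : ContDiff ℝ ∞ gc := Complex.ofRealCLM.contDiff.comp hg
  have hgc2 : HasCompactSupport gc := hgc.comp_left (g := fun x : ℝ => (x : ℂ)) (by simp)
  let G : SchwartzMap ℝ ℂ := hgc2.toSchwartzMap hgc1
  have h1 := congrArg (fun T => T G) (Lp.fourier_toTemperedDistribution_eq (hf.toLp f))
  simp only [TemperedDistribution.fourier_apply, Lp.toTemperedDistribution_apply] at h1
  have h2 := VectorFourier.integral_fourierIntegral_smul_eq_flip (μ := volume) (ν := volume)
    (L := innerₗ ℝ) (f := f) (g := gc) Real.continuous_fourierChar (by fun_prop) hf1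
    (hgc1.continuous.integrable_of_hasCompactSupport hgc2)
  have h3 : (FourierTransform.fourier G : SchwartzMap ℝ ℂ) = FourierTransform.fourier gc := by
    rw [SchwartzMap.fourier_coe]
    rfl
  have h4 : (VectorFourier.fourierIntegral Real.fourierChar volume (innerₗ ℝ).flip gc) =
      FourierTransform.fourier gc := by
    rw [flip_innerₗ]
    rfl
  have h5 : ∀ (x : ℝ) (c : ℂ), g x • c = G x * c := fun x c => Complex.real_smul
  simp_rw [h5]
  simp_rw [smul_eq_mul] at h1 h2
  rw [← h1, h3]
  calc ∫ x, FourierTransform.fourier gc x * hf.toLp f x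
      = ∫ x, f x * FourierTransform.fourier gc x := by
        refine integral_congr_ae ?_
        filter_upwards [hf.coeFn_toLp] with x hx
        rw [hx, mul_comm]
    _ = ∫ x, FourierTransform.fourier f x * gc x := by
        rw [← h4]
        exact h2.symm
    _ = ∫ x, G x * FourierTransform.fourier f x := by
        simp_rw [mul_comm _ (gc _)]
        rfl

open Filter Topology

/-! ### Absolutely continuous complex functions -/

theorem _root_.AbsolutelyContinuousOnInterval.congr {f g : ℝ → ℂ} {a b : ℝ}
    (hf : AbsolutelyContinuousOnInterval f a b) (h : EqOn f g (uIcc a b)) :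
    AbsolutelyContinuousOnInterval g a b := by
  rw [absolutelyContinuousOnInterval_iff] at hf ⊢
  intro ε hε
  obtain ⟨δ, hδ, H⟩ := hf ε hε
  refine ⟨δ, hδ, fun E hE hE' => ?_⟩
  refine lt_of_eq_of_lt (Finset.sum_congr rfl fun i hi => ?_) (H E hE hE')
  rw [h (hE.1 i hi).1, h (hE.1 i hi).2]

theorem absolutelyContinuousOnInterval_const (c : ℂ) (a b : ℝ) :
    AbsolutelyContinuousOnInterval (fun _ => c) a b := by
  simpa [AbsolutelyContinuousOnInterval] using tendsto_const_nhds

theorem _root_.AbsolutelyContinuousOnInterval.conj {f : ℝ → ℂ} {a b : ℝ}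
    (hf : AbsolutelyContinuousOnInterval f a b) :
    AbsolutelyContinuousOnInterval (fun x => conj (f x)) a b := by
  simpa [AbsolutelyContinuousOnInterval, Complex.dist_conj_conj] using hf

theorem _root_.AbsolutelyContinuousOnInterval.ofReal {f : ℝ → ℝ} {a b : ℝ}
    (hf : AbsolutelyContinuousOnInterval f a b) :
    AbsolutelyContinuousOnInterval (fun x => (f x : ℂ)) a b := by
  simpa [AbsolutelyContinuousOnInterval, Complex.dist_eq, Real.dist_eq, ← Complex.ofReal_sub]
    using hf

/-- Reduction to the real-valued case through real and imaginary parts. -/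
theorem _root_.IntervalIntegrable.absolutelyContinuousOnInterval_integral {f : ℝ → ℂ} {a b : ℝ}
    (h : IntervalIntegrable f volume a b) :
    AbsolutelyContinuousOnInterval (fun x => ∫ t in a..x, f t) a b := by
  have hre : IntervalIntegrable (fun x => (f x).re) volume a b :=
    ⟨h.1.re, h.2.re⟩
  have him : IntervalIntegrable (fun x => (f x).im) volume a b :=
    ⟨h.1.im, h.2.im⟩
  have h1 := (hre.absolutelyContinuousOnInterval_intervalIntegral (c := a) left_mem_uIcc).ofReal
  have h2 := (him.absolutelyContinuousOnInterval_intervalIntegral (c := a) left_mem_uIcc).ofReal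
  refine (h1.add (h2.const_smul Complex.I)).congr fun x hx => ?_
  have h3 : IntervalIntegrable f volume a x := h.mono_set (uIcc_subset_uIcc_left hx)
  have h4 : ∫ t in a..x, f t = ∫ t in a..x, ((f t).re : ℂ) + Complex.I * ((f t).im : ℂ) := by
    refine intervalIntegral.integral_congr fun t _ => ?_
    rw [mul_comm, Complex.re_add_im]
  have h5 : IntervalIntegrable (fun x => ((f x).re : ℂ)) volume a x :=
    ⟨h3.1.re.ofReal, h3.2.re.ofReal⟩
  have h6 : IntervalIntegrable (fun x => ((f x).im : ℂ)) volume a x :=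
    ⟨h3.1.im.ofReal, h3.2.im.ofReal⟩
  rw [h4, intervalIntegral.integral_add h5 (h6.const_mul _),
    intervalIntegral.integral_const_mul, intervalIntegral.integral_ofReal,
    intervalIntegral.integral_ofReal]
  rfl

/-- The fundamental theorem of calculus for absolutely continuous functions. -/
theorem _root_.AbsolutelyContinuousOnInterval.integral_eq_sub_of_hasDerivAt {F F' : ℝ → ℂ}
    {a b : ℝ} (hab : a ≤ b) (hF : AbsolutelyContinuousOnInterval F a b)
    (hd : ∀ᵐ x, x ∈ Ioo a b → HasDerivAt F (F' x) x) (hi : IntervalIntegrable F' volume a b) :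
    ∫ x in a..b, F' x = F b - F a := by
  -- `F` minus the primitive of `F'` is absolutely continuous with derivative zero almost
  -- everywhere, hence constant.
  have h1 := hF.sub hi.absolutelyContinuousOnInterval_integral
  obtain ⟨C, hC⟩ := h1.const_of_ae_hasDerivAt_zero (by
    have ha : ∀ᵐ x : ℝ, x ≠ a := by simp [ae_iff]
    have hb : ∀ᵐ x : ℝ, x ≠ b := by simp [ae_iff]
    filter_upwards [hd, hi.ae_hasDerivAt_integral, ha, hb] with x hx1 hx2 hxa hxb hx
    have hx' := hx
    rw [uIcc_of_le hab] at hx'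
    have := (hx1 ⟨lt_of_le_of_ne hx'.1 hxa.symm, lt_of_le_of_ne hx'.2 hxb⟩).sub
      (hx2 hx a left_mem_uIcc)
    rwa [sub_self] at this)
  have h2 := hC a left_mem_uIcc
  have h3 := hC b right_mem_uIcc
  simp only [Pi.sub_apply, intervalIntegral.integral_same, sub_zero] at h2 h3
  rw [h2, ← h3]
  ring

/-- Integrability of the derivative gives `W` a limit at infinity, and integrability of `W` itself
forces that limit to be zero, so only the boundary term at `β` survives. -/
theorem integral_Ioi_eq_neg_of_absolutelyContinuous {W D : ℝ → ℂ} {β : ℝ}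
    (hW : ∀ b ≥ β, AbsolutelyContinuousOnInterval W β b)
    (hd : ∀ᵐ x, x ∈ Ioi β → HasDerivAt W (D x) x) (hWi : IntegrableOn W (Ioi β))
    (hDi : IntegrableOn D (Ioi β)) : ∫ x in Ioi β, D x = -W β := by
  have h1 := intervalIntegral_tendsto_integral_Ioi β hDi tendsto_id
  have h2 : Tendsto W atTop (𝓝 (W β + ∫ x in Ioi β, D x)) := by
    refine (h1.const_add (W β)).congr' ?_
    filter_upwards [eventually_ge_atTop β] with b hb
    rw [id, (hW b hb).integral_eq_sub_of_hasDerivAt hb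
      (hd.mono fun x hx hx' => hx hx'.1) ((intervalIntegrable_iff_integrableOn_Ioc_of_le hb).mpr
        (hDi.mono_set Ioc_subset_Ioi_self))]
    ring
  have h3 : W β + ∫ x in Ioi β, D x = 0 := by
    refine IntegrableAtFilter.eq_zero_of_tendsto (μ := volume)
      ⟨Ioi β, Ioi_mem_atTop β, hWi⟩ (fun s hs => ?_) h2
    obtain ⟨b, hb⟩ := mem_atTop_sets.mp hs
    refine top_le_iff.mp ((Real.volume_Ici (a := b)).symm.le.trans (measure_mono hb))
  linear_combination h3

theorem integral_Iio_eq_of_absolutelyContinuous {W D : ℝ → ℂ} {c : ℝ}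
    (hW : ∀ a ≤ c, AbsolutelyContinuousOnInterval W a c)
    (hd : ∀ᵐ x, x ∈ Iio c → HasDerivAt W (D x) x) (hWi : IntegrableOn W (Iio c))
    (hDi : IntegrableOn D (Iio c)) : ∫ x in Iio c, D x = W c := by
  rw [← integral_Iic_eq_integral_Iio]
  have h1 := intervalIntegral_tendsto_integral_Iic c
    ((integrableOn_Iic_iff_integrableOn_Iio).mpr hDi) tendsto_id
  have h2 : Tendsto W atBot (𝓝 (W c - ∫ x in Iic c, D x)) := by
    refine (h1.const_sub (W c)).congr' ?_
    filter_upwards [eventually_le_atBot c] with a ha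
    rw [id, (hW a ha).integral_eq_sub_of_hasDerivAt ha
      (hd.mono fun x hx hx' => hx hx'.2) ((intervalIntegrable_iff_integrableOn_Ioo_of_le ha).mpr
        (hDi.mono_set Ioo_subset_Iio_self))]
    ring
  have h3 : W c - ∫ x in Iic c, D x = 0 := by
    refine IntegrableAtFilter.eq_zero_of_tendsto (μ := volume)
      ⟨Iio c, Iio_mem_atBot c, hWi⟩ (fun s hs => ?_) h2
    obtain ⟨b, hb⟩ := mem_atBot_sets.mp hs
    refine top_le_iff.mp ((Real.volume_Iic (a := b)).symm.le.trans (measure_mono hb))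
  linear_combination -h3

/-! ### Integration over `Ω` -/

variable {α β : ℝ}

theorem measurableSet_Omega (α β : ℝ) : MeasurableSet (Omega α β) :=
  (isOpen_Omega α β).measurableSet

theorem Iio_subset_Omega : Iio 0 ⊆ Omega α β := fun _ hx => Or.inl (Or.inl hx)

theorem Ioo_subset_Omega : Ioo 1 α ⊆ Omega α β := fun _ hx => Or.inl (Or.inr hx)

theorem Ioi_subset_Omega : Ioi β ⊆ Omega α β := fun _ hx => Or.inr hx

theorem disjoint_Iio_Ioo : Disjoint (Iio (0 : ℝ)) (Ioo 1 α) :=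
  Set.disjoint_left.mpr fun x (hx : x < 0) hx' => by linarith [hx'.1]

theorem disjoint_Iio_union_Ioo_Ioi (hα : 1 < α) (hβ : α < β) :
    Disjoint (Iio (0 : ℝ) ∪ Ioo 1 α) (Ioi β) :=
  Set.disjoint_left.mpr fun x hx (hx' : β < x) => by
    rcases hx with (hx : x < 0) | hx
    · linarith
    · linarith [hx.2]

theorem integral_Omega (hα : 1 < α) (hβ : α < β) {f : ℝ → ℂ} (hf : IntegrableOn f (Omega α β)) :
    ∫ x in Omega α β, f x =
      (∫ x in Iio 0, f x) + (∫ x in Ioo 1 α, f x) + ∫ x in Ioi β, f x := by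
  rw [Omega, setIntegral_union (disjoint_Iio_union_Ioo_Ioi hα hβ) measurableSet_Ioi
      (hf.mono_set subset_union_left) (hf.mono_set subset_union_right),
    setIntegral_union disjoint_Iio_Ioo measurableSet_Ioo (hf.mono_set Iio_subset_Omega)
      (hf.mono_set Ioo_subset_Omega)]

/-- Integration of a derivative over `Ω`. -/
theorem integral_Omega_of_hasDerivAt (hα : 1 < α) (hβ : α < β) {W D : ℝ → ℂ} (hW : IsAC α β W)
    (hd : ∀ᵐ x ∂(volume.restrict (Omega α β)), HasDerivAt W (D x) x)
    (hWi : IntegrableOn W (Omega α β)) (hDi : IntegrableOn D (Omega α β)) :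
    ∫ x in Omega α β, D x = W 0 + (W α - W 1) - W β := by
  rw [ae_restrict_iff' (measurableSet_Omega α β)] at hd
  rw [integral_Omega hα hβ hDi,
    integral_Iio_eq_of_absolutelyContinuous hW.left
      (hd.mono fun x hx hx' => hx (Iio_subset_Omega hx')) (hWi.mono_set Iio_subset_Omega)
      (hDi.mono_set Iio_subset_Omega),
    integral_Ioi_eq_neg_of_absolutelyContinuous hW.right
      (hd.mono fun x hx hx' => hx (Ioi_subset_Omega hx')) (hWi.mono_set Ioi_subset_Omega)
      (hDi.mono_set Ioi_subset_Omega), ← integral_Ioc_eq_integral_Ioo,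
    ← intervalIntegral.integral_of_le hα.le,
    hW.mid.integral_eq_sub_of_hasDerivAt hα.le (hd.mono fun x hx hx' => hx (Ioo_subset_Omega hx'))
      ((intervalIntegrable_iff_integrableOn_Ioo_of_le hα.le).mpr
        (hDi.mono_set Ioo_subset_Omega))]
  ring

theorem IsAC.conj_mul {f g : ℝ → ℂ} (hf : IsAC α β f) (hg : IsAC α β g) :
    IsAC α β (fun x => conj (f x) * g x) :=
  ⟨fun a ha => (hf.left a ha).conj.fun_smul (hg.left a ha), hf.mid.conj.fun_smul hg.mid,
    fun b hb => (hf.right b hb).conj.fun_smul (hg.right b hb)⟩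

/-! ### The domain of the momentum operator -/

variable {θ φ ψ : ℝ}

/-- The decoupling for `w = 0`: the point `0` is linked only to `β`, and `α` only to `1`, in both
cases by a unimodular factor. -/
theorem boundaryCondition_iff {g : ℝ → ℂ} :
    BoundaryCondition α β (boundaryMatrix 0 θ φ ψ) g ↔
      g 0 = -e (θ - ψ) * g β ∧ g α = e ψ * g 1 := by
  unfold BoundaryCondition boundaryMatrix
  rw [funext_iff]
  simp only [Fin.forall_fin_two, Matrix.mulVec, dotProduct, Fin.sum_univ_two]
  simp [eq_comm]

theorem momentum_eq_of_hasDerivAt (hα : 1 ≤ α) {B : Matrix (Fin 2) (Fin 2) ℂ}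
    {f k : L2Omega α β} {g : ℝ → ℂ} (hg : IsAC α β g)
    (hfg : f =ᵐ[volume.restrict (Omega α β)] g) (hb : BoundaryCondition α β B g)
    (hk : ∀ᵐ x ∂(volume.restrict (Omega α β)), HasDerivAt g (2 * Real.pi * Complex.I * k x) x) :
    ∃ hf : f ∈ (momentum α β B).domain, momentum α β B ⟨f, hf⟩ = k := by
  have h1 : (f, k) ∈ (maxMomentum α β).graph := by
    rw [maxMomentum_graph hα]
    exact ⟨g, hg, hfg, hk⟩
  rw [LinearPMap.mem_graph_iff] at h1
  obtain ⟨y, hy1, hy2⟩ := h1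
  replace hy1 : (y : L2Omega α β) = f := hy1
  have hf : f ∈ (momentum α β B).domain := ⟨⟨g, hg, hfg, hb⟩, hy1 ▸ y.2⟩
  exact ⟨hf, (LinearPMap.domRestrict_apply (x := ⟨f, hf⟩) (y := y) hy1.symm).trans hy2⟩

/-- Membership in the domain supplies two versions of `f`, one with the boundary values and one with
the derivative. Both are continuous on the open set `Ω`, so they agree there and the derivative
passes to the version with the boundary values. -/
theorem exists_isAC_of_mem_domain (hα : 1 ≤ α) {B : Matrix (Fin 2) (Fin 2) ℂ}
    (f : (momentum α β B).domain) :
    ∃ g : ℝ → ℂ, IsAC α β g ∧ (f : L2Omega α β) =ᵐ[volume.restrict (Omega α β)] g ∧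
      BoundaryCondition α β B g ∧ ∀ᵐ x ∂(volume.restrict (Omega α β)),
        HasDerivAt g (2 * Real.pi * Complex.I * momentum α β B f x) x := by
  obtain ⟨f, ⟨g, hg, hfg, hb⟩, hf⟩ := f
  have h1 : (f, maxMomentum α β ⟨f, hf⟩) ∈ (maxMomentum α β).graph :=
    LinearPMap.mem_graph _ ⟨f, hf⟩
  rw [maxMomentum_graph hα] at h1
  obtain ⟨g', hg', hfg', hk⟩ := h1
  have heq : EqOn g g' (Omega α β) :=
    Measure.eqOn_open_of_ae_eq (hfg.symm.trans hfg') (isOpen_Omega α β) (hg.continuousOn hα)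
      (hg'.continuousOn hα)
  refine ⟨g, hg, hfg, hb, ?_⟩
  filter_upwards [hk, ae_restrict_mem (measurableSet_Omega α β)] with x hx hx'
  exact hx.congr_of_eventuallyEq (heq.eventuallyEq_of_mem ((isOpen_Omega α β).mem_nhds hx'))

/-- Integrate the derivative of `conj(g₁) g₂` over `Ω`. Since the boundary factors are unimodular,
the contribution at `0` cancels that at `β`, and the one at `α` cancels that at `1`. -/
theorem isFormalAdjoint_momentum (hα : 1 < α) (hβ : α < β) :
    (momentum α β (boundaryMatrix 0 θ φ ψ)).IsFormalAdjoint
      (momentum α β (boundaryMatrix 0 θ φ ψ)) := by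
  intro f₁ f₂
  obtain ⟨g₁, hg₁, hf₁, hb₁, hk₁⟩ := exists_isAC_of_mem_domain hα.le f₁
  obtain ⟨g₂, hg₂, hf₂, hb₂, hk₂⟩ := exists_isAC_of_mem_domain hα.le f₂
  set k₁ := momentum α β (boundaryMatrix 0 θ φ ψ) f₁
  set k₂ := momentum α β (boundaryMatrix 0 θ φ ψ) f₂
  set c : ℂ := 2 * Real.pi * Complex.I with hc
  have hcc : conj c = -c := by simp [hc, Complex.conj_ofNat]
  have hc0 : c ≠ 0 := Complex.two_pi_I_ne_zero
  have i1 := L2.integrable_inner (𝕜 := ℂ) k₁ (f₂ : L2Omega α β)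
  have i2 := L2.integrable_inner (𝕜 := ℂ) (f₁ : L2Omega α β) k₂
  have i3 := L2.integrable_inner (𝕜 := ℂ) (f₁ : L2Omega α β) (f₂ : L2Omega α β)
  have hW : (fun x => inner ℂ ((f₁ : L2Omega α β) x) ((f₂ : L2Omega α β) x))
      =ᵐ[volume.restrict (Omega α β)] fun x => conj (g₁ x) * g₂ x := by
    filter_upwards [hf₁, hf₂] with x h1 h2
    rw [h1, h2, RCLike.inner_apply, mul_comm]
  have hd : ∀ᵐ x ∂(volume.restrict (Omega α β)), HasDerivAt (fun x => conj (g₁ x) * g₂ x)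
      (-c * inner ℂ (k₁ x) ((f₂ : L2Omega α β) x) + c * inner ℂ ((f₁ : L2Omega α β) x) (k₂ x))
      x := by
    filter_upwards [hf₁, hf₂, hk₁, hk₂] with x h1 h2 h3 h4
    have h5 := h3.star.mul h4
    convert! h5 using 1
    rw [h1, h2, RCLike.inner_apply, RCLike.inner_apply, RCLike.star_def, map_mul, hcc]
    ring
  have h := integral_Omega_of_hasDerivAt hα hβ (hg₁.conj_mul hg₂) hd ((integrable_congr hW).mp i3)
    ((i1.const_mul _).add (i2.const_mul _))
  rw [integral_add (i1.const_mul _) (i2.const_mul _), integral_const_mul, integral_const_mul] at h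
  rw [boundaryCondition_iff] at hb₁ hb₂
  rw [L2.inner_def, L2.inner_def]
  have h0 : conj (g₁ 0) * g₂ 0 + (conj (g₁ α) * g₂ α - conj (g₁ 1) * g₂ 1) -
      conj (g₁ β) * g₂ β = 0 := by
    rw [hb₁.1, hb₁.2, hb₂.1, hb₂.2]
    simp only [map_mul, map_neg, conj_e]
    linear_combination (conj (g₁ β) * g₂ β) * e_neg_mul_e (θ - ψ) +
      (conj (g₁ 1) * g₂ 1) * e_neg_mul_e ψ
  rw [h0] at h
  apply mul_left_cancel₀ hc0
  linear_combination -h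

/-! ### The generalized eigenfunctions on the closure of `Ω` -/

open scoped Classical in
/-- The amplitude of the generalized eigenfunction of energy `ξ` that is used in the expansion: at
the bound state energies the amplitude `χ₀`, elsewhere that of a scattering state. -/
def waveAmplitude (α β θ ψ ξ x : ℝ) : ℂ :=
  -- Dropping the scattering states at energies in `Λ` affects only a Lebesgue null set. Non-strict
  -- inequalities give the amplitude its boundary values at `0, 1, α, β`.
  if ξ ∈ boundStates α ψ then (if 1 ≤ x ∧ x ≤ α then 1 else 0)
  else (if x ≤ 0 then -e (θ - ψ + β * ξ) else if β ≤ x then 1 else 0)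

/-- The generalized eigenfunction of energy `ξ` that is used in the expansion. -/
def wave (α β θ ψ ξ x : ℝ) : ℂ := waveAmplitude α β θ ψ ξ x * e (ξ * x)

theorem measurable_wave (α β θ ψ : ℝ) :
    Measurable fun p : ℝ × ℝ => wave α β θ ψ p.1 p.2 := by
  unfold wave waveAmplitude
  refine Measurable.mul ?_ (by fun_prop)
  refine Measurable.ite (measurable_fst (measurableSet_boundStates α ψ)) ?_ ?_
  · exact Measurable.ite ((measurableSet_le measurable_const measurable_snd).inter
      (measurableSet_le measurable_snd measurable_const)) measurable_const measurable_const
  · refine Measurable.ite (measurableSet_le measurable_snd measurable_const) ?_ ?_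
    · exact (continuous_e.comp (by fun_prop)).neg.measurable
    · exact Measurable.ite (measurableSet_le measurable_const measurable_snd) measurable_const
        measurable_const

theorem norm_wave_le (α β θ ψ ξ x : ℝ) : ‖wave α β θ ψ ξ x‖ ≤ 1 := by
  unfold wave waveAmplitude
  rw [norm_mul, norm_e, mul_one]
  split_ifs <;> simp [norm_e]

/-- The boundary condition holds for each energy separately, so an absolutely convergent
superposition of waves inherits it. -/
theorem wave_boundary (hα : 1 < α) (hβ : α < β) (ξ : ℝ) :
    wave α β θ ψ ξ 0 = -e (θ - ψ) * wave α β θ ψ ξ β ∧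
      wave α β θ ψ ξ α = e ψ * wave α β θ ψ ξ 1 := by
  unfold wave waveAmplitude
  by_cases hξ : ξ ∈ boundStates α ψ
  · have h1 := (mem_boundStates_iff hα ξ).mp hξ
    simp only [hξ, if_true]
    refine ⟨?_, ?_⟩
    · rw [if_neg (by norm_num), if_neg (by intro h; linarith [h.2])]
      simp
    · rw [if_pos ⟨hα.le, le_rfl⟩, if_pos ⟨le_rfl, hα.le⟩, ← h1, one_mul, one_mul, ← e_add]
      ring_nf
  · simp only [hξ, if_false]
    refine ⟨?_, ?_⟩
    · rw [if_pos le_rfl, if_neg (by linarith), if_pos le_rfl, e_add, mul_zero, e_zero, mul_comm β]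
      ring
    · rw [if_neg (by linarith), if_neg (by linarith), if_neg (by norm_num),
        if_neg (by linarith)]
      simp

/-- The closures of the three components of `Ω`. -/
def IsClosedComponent (α β : ℝ) (C : Set ℝ) : Prop := C = Iic 0 ∨ C = Icc 1 α ∨ C = Ici β

theorem IsClosedComponent.Icc_subset {C : Set ℝ} (hC : IsClosedComponent α β C) {x y : ℝ}
    (hx : x ∈ C) (hy : y ∈ C) : Icc x y ⊆ C := by
  rcases hC with rfl | rfl | rfl <;> exact OrdConnected.out inferInstance hx hy

theorem IsClosedComponent.Ioo_subset_Omega {C : Set ℝ} (hC : IsClosedComponent α β C) {x y : ℝ}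
    (hx : x ∈ C) (hy : y ∈ C) : Ioo x y ⊆ Omega α β := by
  rcases hC with rfl | rfl | rfl <;> intro t ht
  · exact Iio_subset_Omega (ht.2.trans_le hy)
  · exact TwoIntervals.Ioo_subset_Omega ⟨hx.1.trans_lt ht.1, ht.2.trans_le hy.2⟩
  · exact Ioi_subset_Omega (lt_of_le_of_lt hx ht.1)

theorem IsClosedComponent.waveAmplitude_eq (hα : 1 < α) (hβ : α < β) {C : Set ℝ}
    (hC : IsClosedComponent α β C) {x y : ℝ} (hx : x ∈ C) (hy : y ∈ C) (ξ : ℝ) :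
    waveAmplitude α β θ ψ ξ x = waveAmplitude α β θ ψ ξ y := by
  unfold waveAmplitude
  rcases hC with rfl | rfl | rfl
  · rw [mem_Iic] at hx hy
    simp [hx, hy, show ¬ 1 ≤ x by linarith, show ¬ 1 ≤ y by linarith]
  · simp [hx.1, hx.2, hy.1, hy.2, show ¬ x ≤ 0 by linarith [hx.1], show ¬ y ≤ 0 by linarith [hy.1],
      show ¬ β ≤ x by linarith [hx.2], show ¬ β ≤ y by linarith [hy.2]]
  · rw [mem_Ici] at hx hy
    simp [hx, hy, show ¬ x ≤ 0 by linarith, show ¬ y ≤ 0 by linarith, show ¬ x ≤ α by linarith,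
      show ¬ y ≤ α by linarith]

/-- Multiplied through by the frequency rather than divided by it, so that `ξ = 0` is included. -/
theorem integral_e_mul (ξ x y : ℝ) :
    2 * Real.pi * Complex.I * ξ * ∫ t in x..y, e (ξ * t) = e (ξ * y) - e (ξ * x) := by
  rw [← intervalIntegral.integral_const_mul]
  refine intervalIntegral.integral_eq_sub_of_hasDerivAt (fun t _ => hasDerivAt_e_mul ξ t) ?_
  exact Continuous.intervalIntegrable (by fun_prop) _ _

theorem IsClosedComponent.integral_wave (hα : 1 < α) (hβ : α < β) {C : Set ℝ}
    (hC : IsClosedComponent α β C) {x y : ℝ} (hxy : x ≤ y) (hx : x ∈ C) (hy : y ∈ C) (ξ : ℝ) :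
    2 * Real.pi * Complex.I * ξ * ∫ t in x..y, wave α β θ ψ ξ t =
      wave α β θ ψ ξ y - wave α β θ ψ ξ x := by
  have h1 : ∫ t in x..y, wave α β θ ψ ξ t =
      waveAmplitude α β θ ψ ξ x * ∫ t in x..y, e (ξ * t) := by
    rw [← intervalIntegral.integral_const_mul]
    refine intervalIntegral.integral_congr fun t ht => ?_
    rw [uIcc_of_le hxy] at ht
    simp only [wave]
    rw [hC.waveAmplitude_eq hα hβ hx (hC.Icc_subset hx hy ht)]
  rw [h1, wave, wave, hC.waveAmplitude_eq hα hβ hy hx]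
  linear_combination (waveAmplitude α β θ ψ ξ x) * integral_e_mul ξ x y

/-- `Ω` is a countable union of bounded intervals with endpoints in a single closed component. -/
theorem ae_restrict_Omega_of_forall_Ioo {p : ℝ → Prop}
    (h : ∀ C, IsClosedComponent α β C → ∀ x ∈ C, ∀ y ∈ C, x ≤ y → ∀ᵐ t, t ∈ Ioo x y → p t)
    (hα : 1 ≤ α) : ∀ᵐ t ∂(volume.restrict (Omega α β)), p t := by
  rw [ae_restrict_iff' (measurableSet_Omega α β)]
  have h1 : ∀ᵐ t : ℝ, ∀ n : ℕ, t ∈ Ioo (-(n : ℝ)) 0 → p t :=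
    ae_all_iff.mpr fun n => h (Iic 0) (Or.inl rfl) _ (by simp) 0 (by simp) (by simp)
  have h2 : ∀ᵐ t : ℝ, ∀ n : ℕ, t ∈ Ioo β (β + n) → p t :=
    ae_all_iff.mpr fun n => h (Ici β) (Or.inr (Or.inr rfl)) _ (by simp) _ (by simp) (by simp)
  have h3 := h (Icc 1 α) (Or.inr (Or.inl rfl)) 1 ⟨le_rfl, hα⟩ α ⟨hα, le_rfl⟩ hα
  filter_upwards [h1, h2, h3] with t h1 h2 h3 ht
  rcases ht with (ht | ht) | ht
  · obtain ⟨n, hn⟩ := exists_nat_gt (-t)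
    exact h1 n ⟨by linarith, ht⟩
  · exact h3 ht
  · obtain ⟨n, hn⟩ := exists_nat_gt (t - β)
    exact h2 n ⟨ht, by linarith⟩

theorem ae_hasDerivAt_of_forall_integral_eq {F k : ℝ → ℂ} {x y : ℝ} (hxy : x ≤ y)
    (hk : IntervalIntegrable k volume x y)
    (h : ∀ t ∈ Icc x y, F t - F x = ∫ s in x..t, k s) :
    ∀ᵐ t, t ∈ Ioo x y → HasDerivAt F (k t) t := by
  filter_upwards [hk.ae_hasDerivAt_integral] with t ht htI
  have h1 := (ht (by rw [uIcc_of_le hxy]; exact Ioo_subset_Icc_self htI) x left_mem_uIcc).const_add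
    (F x)
  refine h1.congr_of_eventuallyEq ?_
  filter_upwards [Icc_mem_nhds htI.1 htI.2] with s hs
  rw [← h s hs]
  ring

theorem IsClosedComponent.intervalIntegrable {C : Set ℝ} (hC : IsClosedComponent α β C) {x y : ℝ}
    (hxy : x ≤ y) (hx : x ∈ C) (hy : y ∈ C) (f : L2Omega α β) :
    IntervalIntegrable f volume x y := by
  rw [intervalIntegrable_iff_integrableOn_Ioo_of_le hxy]
  have h1 := (Lp.memLp f).restrict (Ioo x y)
  rw [Measure.restrict_restrict measurableSet_Ioo,
    inter_eq_self_of_subset_left (hC.Ioo_subset_Omega hx hy)] at h1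
  exact h1.integrable one_le_two

/-! ### Functions with `ξ U f` square integrable are in the domain -/

/-- The unitary `U` is given by integration against the generalized eigenfunctions. -/
def IsWaveTransform (α β θ ψ : ℝ) (U : L2Omega α β ≃ₗᵢ[ℂ] Lp ℂ 2 (spectralMeasure α ψ)) : Prop :=
  ∀ f : L2Omega α β, Integrable f (volume.restrict (Omega α β)) →
    ∀ᵐ ξ ∂(spectralMeasure α ψ), U f ξ = ∫ x in Omega α β, conj (wave α β θ ψ ξ x) * f x

variable {U : L2Omega α β ≃ₗᵢ[ℂ] Lp ℂ 2 (spectralMeasure α ψ)}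

/-- Unitarity of `U` applied to `f` and the indicator of `(x, y)`. This is the inversion formula in
integrated form, valid for every `f` in `L²` without any convergence assumption. -/
theorem IsWaveTransform.intervalIntegral_eq (hU : IsWaveTransform α β θ ψ U) {C : Set ℝ}
    (hC : IsClosedComponent α β C) {x y : ℝ} (hxy : x ≤ y) (hx : x ∈ C) (hy : y ∈ C)
    (f : L2Omega α β) :
    ∫ t in x..y, f t = ∫ ξ, U f ξ * (∫ t in x..y, wave α β θ ψ ξ t) ∂(spectralMeasure α ψ) := by
  have hsub : Ioo x y ∩ Omega α β = Ioo x y :=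
    inter_eq_self_of_subset_left (hC.Ioo_subset_Omega hx hy)
  have hfin : volume.restrict (Omega α β) (Ioo x y) ≠ ⊤ := by
    rw [Measure.restrict_apply measurableSet_Ioo, hsub]
    exact measure_Ioo_lt_top.ne
  set k : L2Omega α β := indicatorConstLp 2 measurableSet_Ioo hfin (1 : ℂ) with hk
  have hkc : k =ᵐ[volume.restrict (Omega α β)] (Ioo x y).indicator fun _ => (1 : ℂ) :=
    indicatorConstLp_coeFn
  have hki : Integrable k (volume.restrict (Omega α β)) :=
    (integrable_congr hkc).mpr ((integrable_indicator_iff measurableSet_Ioo).mpr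
      (integrableOn_const hfin))
  have h1 : inner ℂ k f = ∫ t in x..y, f t := by
    rw [hk, L2.inner_indicatorConstLp_one, Measure.restrict_restrict measurableSet_Ioo, hsub,
      intervalIntegral.integral_of_le hxy, integral_Ioc_eq_integral_Ioo]
  rw [← h1, ← U.inner_map_map, L2.inner_def]
  refine integral_congr_ae ?_
  filter_upwards [hU k hki] with ξ hξ
  rw [RCLike.inner_apply, hξ]
  congr 1
  rw [← integral_conj, intervalIntegral.integral_of_le hxy, integral_Ioc_eq_integral_Ioo, ← hsub,
    ← Measure.restrict_restrict measurableSet_Ioo, ← integral_indicator measurableSet_Ioo]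
  refine integral_congr_ae ?_
  filter_upwards [hkc] with t ht
  rw [ht]
  by_cases h : t ∈ Ioo x y
  · simp [indicator_of_mem h]
  · simp [indicator_of_notMem h]

theorem integrable_of_memLp_mul (hα : 1 < α) {h : ℝ → ℂ} (h1 : MemLp h 2 (spectralMeasure α ψ))
    (h2 : MemLp (fun ξ : ℝ => (ξ : ℂ) * h ξ) 2 (spectralMeasure α ψ)) :
    Integrable h (spectralMeasure α ψ) := by
  have i1 := h1.integrable_norm_pow two_ne_zero
  have i2 := h2.integrable_norm_pow two_ne_zero
  refine ((integrable_inv_one_add_sq_spectralMeasure hα ψ).add (i1.add i2)).mono'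
    h1.aestronglyMeasurable (ae_of_all _ fun ξ => ?_)
  simp only [Pi.add_apply, norm_mul, Complex.norm_real, Real.norm_eq_abs, mul_pow, sq_abs]
  have h3 : 0 < 1 + ξ ^ 2 := by positivity
  -- Completing the square yields `2 |h| ≤ (1 + ξ²)⁻¹ + (1 + ξ²) |h|²`, and both terms on the right
  -- are integrable.
  have h4 : (1 + ξ ^ 2)⁻¹ + (1 + ξ ^ 2) * ‖h ξ‖ ^ 2 - 2 * ‖h ξ‖ =
      (1 + ξ ^ 2)⁻¹ * (1 - (1 + ξ ^ 2) * ‖h ξ‖) ^ 2 := by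
    field_simp
    ring
  have h5 : 0 ≤ (1 + ξ ^ 2)⁻¹ * (1 - (1 + ξ ^ 2) * ‖h ξ‖) ^ 2 := by positivity
  have h6 := norm_nonneg (h ξ)
  nlinarith

/-- The extra decay makes `U f` integrable, so the inversion integral `g` exists at every point,
including the boundary points. It is a version of `f`, and `2πi k` with `k = U⁻¹(ξ U f)` is its
derivative. -/
theorem IsWaveTransform.exists_mem_domain (hα : 1 < α) (hβ : α < β)
    (hU : IsWaveTransform α β θ ψ U) (f : L2Omega α β)
    (hf : MemLp (fun ξ : ℝ => (ξ : ℂ) * U f ξ) 2 (spectralMeasure α ψ)) :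
    ∃ hf : f ∈ (momentum α β (boundaryMatrix 0 θ φ ψ)).domain,
      U (momentum α β (boundaryMatrix 0 θ φ ψ) ⟨f, hf⟩) =ᵐ[spectralMeasure α ψ]
        fun ξ : ℝ => (ξ : ℂ) * U f ξ := by
  have := sigmaFinite_spectralMeasure hα ψ
  have hint : Integrable (U f) (spectralMeasure α ψ) := integrable_of_memLp_mul hα (Lp.memLp _) hf
  have hwm : ∀ x, Measurable fun ξ => wave α β θ ψ ξ x := fun x =>
    (measurable_wave α β θ ψ).comp (by fun_prop : Measurable fun ξ : ℝ => (ξ, x))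
  have hint' : ∀ x, Integrable (fun ξ => U f ξ * wave α β θ ψ ξ x) (spectralMeasure α ψ) := fun x =>
    hint.mul_bdd (c := 1) (hwm x).aestronglyMeasurable
      (ae_of_all _ fun ξ => norm_wave_le α β θ ψ ξ x)
  set g : ℝ → ℂ := fun x => ∫ ξ, U f ξ * wave α β θ ψ ξ x ∂(spectralMeasure α ψ) with hg
  set k : L2Omega α β := U.symm (hf.toLp _) with hk
  have hUk : U k =ᵐ[spectralMeasure α ψ] fun ξ : ℝ => (ξ : ℂ) * U f ξ := by
    rw [hk, U.apply_symm_apply]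
    exact hf.coeFn_toLp
  -- Integrated inversion for `k` produces the factor `ξ ∫ wave`, which up to `2πi` is the increment
  -- of the wave; hence `g` is a primitive of `2πi k`.
  have hsub : ∀ C, IsClosedComponent α β C → ∀ x ∈ C, ∀ y ∈ C, x ≤ y →
      g y - g x = ∫ t in x..y, 2 * Real.pi * Complex.I * k t := by
    intro C hC x hx y hy hxy
    rw [intervalIntegral.integral_const_mul, hU.intervalIntegral_eq hC hxy hx hy k, hg]
    simp only
    rw [← integral_sub (hint' y) (hint' x), ← integral_const_mul]
    refine integral_congr_ae ?_
    filter_upwards [hUk] with ξ hξ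
    rw [hξ, ← mul_sub, ← hC.integral_wave hα hβ hxy hx hy]
    ring
  have hki : ∀ C, IsClosedComponent α β C → ∀ x ∈ C, ∀ y ∈ C, x ≤ y →
      IntervalIntegrable (fun t => 2 * Real.pi * Complex.I * k t) volume x y :=
    fun C hC x hx y hy hxy => (hC.intervalIntegrable hxy hx hy k).const_mul _
  have hac : ∀ C, IsClosedComponent α β C → ∀ x ∈ C, ∀ y ∈ C, x ≤ y →
      AbsolutelyContinuousOnInterval g x y := by
    intro C hC x hx y hy hxy
    refine ((absolutelyContinuousOnInterval_const (g x) x y).add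
      (hki C hC x hx y hy hxy).absolutelyContinuousOnInterval_integral).congr fun t ht => ?_
    rw [uIcc_of_le hxy] at ht
    rw [Pi.add_apply, ← hsub C hC x hx t (hC.Icc_subset hx hy ht) ht.1]
    ring
  have hprod : ∀ x y, Integrable (fun p : ℝ × ℝ => U f p.1 * wave α β θ ψ p.1 p.2)
      ((spectralMeasure α ψ).prod (volume.restrict (Ioc x y))) := by
    intro x y
    refine (hint.comp_fst (volume.restrict (Ioc x y))).mul_bdd (c := 1)
      (measurable_wave α β θ ψ).aestronglyMeasurable
      (ae_of_all _ fun p => norm_wave_le α β θ ψ p.1 p.2)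
  have hgi : ∀ x y, x ≤ y → IntervalIntegrable g volume x y := fun x y hxy => by
    rw [intervalIntegrable_iff_integrableOn_Ioc_of_le hxy]
    exact (hprod x y).integral_prod_right
  have hfg : f =ᵐ[volume.restrict (Omega α β)] g := by
    refine ae_restrict_Omega_of_forall_Ioo (fun C hC x hx y hy hxy => ?_) hα.le
    -- By integrated inversion and Fubini, `f - g` has zero integral over every subinterval starting
    -- at `x`. The zero function is therefore its primitive, and Lebesgue differentiation gives `f =
    -- g` almost everywhere.
    have h1 := ae_hasDerivAt_of_forall_integral_eq (F := 0) (k := fun t => f t - g t) hxy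
      ((hC.intervalIntegrable hxy hx hy f).sub (hgi x y hxy)) (fun t ht => by
        have htC := hC.Icc_subset hx hy ht
        rw [intervalIntegral.integral_sub (hC.intervalIntegrable ht.1 hx htC f) (hgi x t ht.1),
          hU.intervalIntegral_eq hC ht.1 hx htC f]
        simp only [Pi.zero_apply, sub_self, hg, intervalIntegral.integral_of_le ht.1]
        rw [← integral_integral_swap (hprod x t)]
        simp_rw [integral_const_mul]
        rw [sub_self])
    filter_upwards [h1] with t ht htI
    have h2 := (ht htI).unique (hasDerivAt_const t (0 : ℂ))
    exact sub_eq_zero.mp h2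
  have hIsAC : IsAC α β g :=
    ⟨fun a ha => hac _ (Or.inl rfl) a ha 0 self_mem_Iic ha,
      hac _ (Or.inr (Or.inl rfl)) 1 ⟨le_rfl, hα.le⟩ α ⟨hα.le, le_rfl⟩ hα.le,
      fun b hb => hac _ (Or.inr (Or.inr rfl)) β self_mem_Ici b hb hb⟩
  have hbc : BoundaryCondition α β (boundaryMatrix 0 θ φ ψ) g := by
    rw [boundaryCondition_iff]
    simp only [hg]
    rw [← integral_const_mul, ← integral_const_mul]
    constructor <;> congr 1 <;> ext ξ
    · rw [(wave_boundary hα hβ ξ).1]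
      ring
    · rw [(wave_boundary hα hβ (θ := θ) ξ).2]
      ring
  have hder : ∀ᵐ x ∂(volume.restrict (Omega α β)),
      HasDerivAt g (2 * Real.pi * Complex.I * k x) x :=
    ae_restrict_Omega_of_forall_Ioo (fun C hC x hx y hy hxy =>
      ae_hasDerivAt_of_forall_integral_eq hxy (hki C hC x hx y hy hxy) fun t ht =>
        hsub C hC x hx t (hC.Icc_subset hx hy ht) ht.1) hα.le
  obtain ⟨hf1, hf2⟩ := momentum_eq_of_hasDerivAt hα.le hIsAC hfg hbc hder
  exact ⟨hf1, by rw [hf2]; exact hUk⟩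

theorem IsWaveTransform.isSpectralRepresentation (hα : 1 < α) (hβ : α < β)
    (hU : IsWaveTransform α β θ ψ U) :
    IsSpectralRepresentation (momentum α β (boundaryMatrix 0 θ φ ψ)) (spectralMeasure α ψ) U :=
  isSpectralRepresentation_of_isFormalAdjoint (isFormalAdjoint_momentum hα hβ)
    (hU.exists_mem_domain hα hβ)

open FourierTransform

/-! ### Glueing the two unbounded components -/

theorem measurePreserving_add_Ioi (β : ℝ) :
    MeasurePreserving (fun y : ℝ => y + β) (volume.restrict (Ioi 0)) (volume.restrict (Ioi β)) := by
  have h := (measurePreserving_add_right volume β).restrict_preimage (s := Ioi β) measurableSet_Ioi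
  have h1 : (fun y : ℝ => y + β) ⁻¹' Ioi β = Ioi 0 := by
    ext y
    simp
  rwa [h1] at h

/-- The function on the line obtained by glueing the restrictions of `f` to `(-∞, 0)` and `(β, ∞)`
according to the boundary condition. -/
def glue (β θ ψ : ℝ) (f : ℝ → ℂ) (y : ℝ) : ℂ :=
  -- The factor `-e(ψ - θ)` inverts the one in `f(0) = -e(θ - ψ) f(β)`, so the one-sided values
  -- match at the seam.
  if 0 < y then f (y + β) else -e (ψ - θ) * f y

theorem glue_eq_indicator (f : ℝ → ℂ) :
    glue β θ ψ f = (Ioi (0 : ℝ)).indicator (fun y => f (y + β)) +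
      (Iic (0 : ℝ)).indicator fun y => -e (ψ - θ) * f y := by
  ext y
  by_cases h : 0 < y
  · simp [glue, h, not_le.mpr h]
  · simp [glue, h, not_lt.mp h]

theorem memLp_glue {p : ENNReal} {f : ℝ → ℂ} (hf : MemLp f p (volume.restrict (Omega α β))) :
    MemLp (glue β θ ψ f) p volume := by
  rw [glue_eq_indicator]
  refine MemLp.add ?_ ?_
  · rw [memLp_indicator_iff_restrict measurableSet_Ioi]
    exact (hf.mono_measure (Measure.restrict_mono Ioi_subset_Omega le_rfl)).comp_measurePreserving
      (measurePreserving_add_Ioi β)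
  · rw [memLp_indicator_iff_restrict measurableSet_Iic, ← restrict_Iio_eq_restrict_Iic]
    exact (hf.mono_measure (Measure.restrict_mono Iio_subset_Omega le_rfl)).const_mul _

theorem ae_glue {p : ℝ → Prop} (h : ∀ᵐ x ∂(volume.restrict (Omega α β)), p x) :
    ∀ᵐ y : ℝ, (0 < y → p (y + β)) ∧ (y < 0 → p y) := by
  rw [ae_restrict_iff' (measurableSet_Omega α β)] at h
  have h1 := (measurePreserving_add_right volume β).quasiMeasurePreserving.ae h
  filter_upwards [h, h1] with y h2 h3
  exact ⟨fun hy => h3 (Ioi_subset_Omega (show β < y + β by linarith)),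
    fun hy => h2 (Iio_subset_Omega hy)⟩

theorem ae_ne_zero : ∀ᵐ y : ℝ, y ≠ 0 := by simp [ae_iff]

theorem glue_add (f g : ℝ → ℂ) : glue β θ ψ (f + g) = glue β θ ψ f + glue β θ ψ g := by
  ext y
  by_cases h : 0 < y
  · simp [glue, h]
  · simp only [glue, h, if_false, Pi.add_apply]
    ring

theorem glue_smul (c : ℂ) (f : ℝ → ℂ) : glue β θ ψ (c • f) = c • glue β θ ψ f := by
  ext y
  by_cases h : 0 < y
  · simp [glue, h]
  · simp only [glue, h, if_false, Pi.smul_apply, smul_eq_mul]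
    ring

theorem glue_congr_ae {f g : ℝ → ℂ} (h : f =ᵐ[volume.restrict (Omega α β)] g) :
    glue β θ ψ f =ᵐ[volume] glue β θ ψ g := by
  filter_upwards [ae_glue h, ae_ne_zero] with y hy hy0
  by_cases h : 0 < y
  · simp [glue, h, hy.1 h]
  · simp [glue, h, hy.2 (lt_of_le_of_ne (not_lt.mp h) hy0)]

theorem lintegral_glue (f : ℝ → ℂ) :
    ∫⁻ y, ‖glue β θ ψ f y‖ₑ ^ 2 =
      (∫⁻ x in Iio 0, ‖f x‖ₑ ^ 2) + ∫⁻ x in Ioi β, ‖f x‖ₑ ^ 2 := by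
  rw [← lintegral_add_compl _ (measurableSet_Iic (a := (0 : ℝ))), compl_Iic]
  congr 1
  · rw [restrict_Iio_eq_restrict_Iic]
    refine setLIntegral_congr_fun measurableSet_Iic fun y (hy : y ≤ 0) => ?_
    simp only [glue, not_lt.mpr hy, if_false]
    rw [← ofReal_norm, norm_mul, norm_neg, norm_e, one_mul, ofReal_norm]
  · rw [← (measurePreserving_add_Ioi β).lintegral_comp_emb (measurableEmbedding_addRight β)]
    refine setLIntegral_congr_fun measurableSet_Ioi fun y (hy : 0 < y) => ?_
    simp only [glue, hy, if_true]

/-- The glueing map on `L²`. -/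
def glueLp (α β θ ψ : ℝ) : L2Omega α β →ₗ[ℂ] Lp ℂ 2 (volume : Measure ℝ) where
  toFun f := (memLp_glue (θ := θ) (ψ := ψ) (Lp.memLp f)).toLp _
  map_add' f g := by
    rw [← MemLp.toLp_add]
    refine MemLp.toLp_congr _ _ ?_
    rw [← glue_add]
    exact glue_congr_ae (Lp.coeFn_add f g)
  map_smul' c f := by
    rw [RingHom.id_apply, ← MemLp.toLp_const_smul]
    refine MemLp.toLp_congr _ _ ?_
    rw [← glue_smul]
    exact glue_congr_ae (Lp.coeFn_smul c f)

/-! ### The Fourier coefficients of the bounded component -/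

theorem integrableOn_Ioo_L2Omega (f : L2Omega α β) : IntegrableOn f (Ioo 1 α) :=
  ((Lp.memLp f).mono_measure (Measure.restrict_mono Ioo_subset_Omega le_rfl)).integrable one_le_two

theorem integrableOn_e_mul (ξ : ℝ) {f : ℝ → ℂ} {s : Set ℝ} (hf : IntegrableOn f s) :
    IntegrableOn (fun x => e (ξ * x) * f x) s :=
  Integrable.bdd_mul (c := 1) hf (by fun_prop : Continuous fun x => e (ξ * x)).aestronglyMeasurable
    (ae_of_all _ fun x => (norm_e _).le)

/-- The integral of `f` against `χ₀ e_ξ`. -/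
def innerCoeff (α β ξ : ℝ) : L2Omega α β →ₗ[ℂ] ℂ where
  toFun f := ∫ x in Ioo 1 α, e (-ξ * x) * f x
  map_add' f g := by
    rw [← integral_add (integrableOn_e_mul _ (integrableOn_Ioo_L2Omega f))
      (integrableOn_e_mul _ (integrableOn_Ioo_L2Omega g))]
    refine integral_congr_ae ?_
    filter_upwards [ae_restrict_of_ae_restrict_of_subset Ioo_subset_Omega (Lp.coeFn_add f g)]
      with x hx
    rw [hx, Pi.add_apply, mul_add]
  map_smul' c f := by
    rw [RingHom.id_apply, smul_eq_mul, ← integral_const_mul]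
    refine integral_congr_ae ?_
    filter_upwards [ae_restrict_of_ae_restrict_of_subset Ioo_subset_Omega (Lp.coeFn_smul c f)]
      with x hx
    rw [hx, Pi.smul_apply, smul_eq_mul]
    ring

theorem innerCoeff_apply (ξ : ℝ) (f : L2Omega α β) :
    innerCoeff α β ξ f = ∫ x in Ioo 1 α, e (-ξ * x) * f x := rfl

theorem fourier_intCast_eq_e (n : ℤ) (T x : ℝ) :
    fourier n (x : AddCircle T) = e (n / T * x) := by
  rw [fourier_coe_apply, e]
  congr 1
  push_cast
  ring

/-- Multiplication by `e(-ψ x / (α-1))` shifts `Λ` to `ℤ / (α-1)`, and Parseval for Fourier series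
on an interval of length `α - 1` applies. The weight is the mass of the atoms of `ν`. -/
theorem hasSum_norm_innerCoeff_sq (hα : 1 < α) (ψ : ℝ) (f : L2Omega α β) :
    HasSum (fun n : ℤ => 1 / (α - 1) * ‖innerCoeff α β (ψ / (α - 1) + n / (α - 1)) f‖ ^ 2)
      (∫ x in Ioo 1 α, ‖f x‖ ^ 2) := by
  have h0 : 0 < α - 1 := by linarith
  set g : ℝ → ℂ := fun x => e (-(ψ / (α - 1)) * x) * f x with hg
  have hf : MemLp f 2 (volume.restrict (Ioc 1 α)) := by
    rw [← restrict_Ioo_eq_restrict_Ioc]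
    exact (Lp.memLp f).mono_measure (Measure.restrict_mono Ioo_subset_Omega le_rfl)
  have hgm : MemLp g 2 (volume.restrict (Ioc 1 α)) :=
    hf.of_le ((by fun_prop : Continuous fun x => e (-(ψ / (α - 1)) * x)).aestronglyMeasurable.mul
      hf.aestronglyMeasurable) (ae_of_all _ fun x => by
        simp only [hg, norm_mul, norm_e, one_mul, le_refl])
  have h1 := (hasSum_sq_fourierCoeffOn hα hgm).mul_left (α - 1)
  have h2 : ∀ n : ℤ, fourierCoeffOn hα g n =
      (1 / (α - 1) : ℝ) * innerCoeff α β (ψ / (α - 1) + n / (α - 1)) f := by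
    intro n
    rw [fourierCoeffOn_eq_integral, Complex.real_smul, innerCoeff_apply,
      intervalIntegral.integral_of_le hα.le, integral_Ioc_eq_integral_Ioo]
    congr 1
    refine integral_congr_ae (ae_of_all _ fun x => ?_)
    simp only [hg]
    rw [fourier_intCast_eq_e, smul_eq_mul, ← mul_assoc, ← e_add]
    congr 2
    push_cast
    ring
  convert! h1 using 1
  · ext n
    rw [h2, norm_mul, Complex.norm_real, Real.norm_of_nonneg (by positivity)]
    field_simp
  · rw [intervalIntegral.integral_of_le hα.le, integral_Ioc_eq_integral_Ioo, smul_eq_mul,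
      mul_inv_cancel_left₀ h0.ne']
    simp only [hg, norm_mul, norm_e, one_mul]

/-! ### The expansion in generalized eigenfunctions -/

open scoped Classical in
/-- The coefficients of `f` with respect to the generalized eigenfunctions. -/
def expansion (α β θ ψ : ℝ) (f : L2Omega α β) (ξ : ℝ) : ℂ :=
  if ξ ∈ boundStates α ψ then innerCoeff α β ξ f
  -- The phase undoes the translation by `β` made in the glueing, so that the amplitude on `(β, ∞)`
  -- is `1`.
  else e (-β * ξ) * (𝓕 (glueLp α β θ ψ f) : Lp ℂ 2 (volume : Measure ℝ)) ξ

theorem expansion_of_mem {ξ : ℝ} (hξ : ξ ∈ boundStates α ψ) (f : L2Omega α β) :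
    expansion α β θ ψ f ξ = innerCoeff α β ξ f := if_pos hξ

theorem expansion_of_notMem {ξ : ℝ} (hξ : ξ ∉ boundStates α ψ) (f : L2Omega α β) :
    expansion α β θ ψ f ξ =
      e (-β * ξ) * (𝓕 (glueLp α β θ ψ f) : Lp ℂ 2 (volume : Measure ℝ)) ξ := if_neg hξ

theorem eLpNorm_two_sq {E : Type*} [NormedAddCommGroup E] {μ : Measure ℝ} (f : ℝ → E) :
    eLpNorm f 2 μ ^ 2 = ∫⁻ x, ‖f x‖ₑ ^ 2 ∂μ := by
  have h := eLpNorm_nnreal_pow_eq_lintegral (f := f) (μ := μ) (p := 2) two_ne_zero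
  simpa using h

theorem lintegral_Omega (hα : 1 < α) (hβ : α < β) (f : ℝ → ENNReal) :
    ∫⁻ x in Omega α β, f x =
      (∫⁻ x in Iio 0, f x) + (∫⁻ x in Ioo 1 α, f x) + ∫⁻ x in Ioi β, f x := by
  rw [Omega, lintegral_union measurableSet_Ioi (disjoint_Iio_union_Ioo_Ioi hα hβ),
    lintegral_union measurableSet_Ioo disjoint_Iio_Ioo]

/-- Plancherel on the glued line accounts for the two half-lines and the Lebesgue part of `ν`;
Parseval on `(1, α)` accounts for the atoms. -/
theorem eLpNorm_expansion (hα : 1 < α) (hβ : α < β) (f : L2Omega α β) :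
    eLpNorm (expansion α β θ ψ f) 2 (spectralMeasure α ψ) =
      eLpNorm f 2 (volume.restrict (Omega α β)) := by
  have h0 : 0 < α - 1 := by linarith
  have hcont : ∫⁻ ξ, ‖expansion α β θ ψ f ξ‖ₑ ^ 2 =
      (∫⁻ x in Iio 0, ‖f x‖ₑ ^ 2) + ∫⁻ x in Ioi β, ‖f x‖ₑ ^ 2 := by
    have h1 : ∫⁻ ξ, ‖expansion α β θ ψ f ξ‖ₑ ^ 2 =
        ∫⁻ ξ, ‖(𝓕 (glueLp α β θ ψ f) : Lp ℂ 2 (volume : Measure ℝ)) ξ‖ₑ ^ 2 := by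
      refine lintegral_congr_ae ?_
      filter_upwards [ae_notMem_boundStates α ψ] with ξ hξ
      rw [expansion_of_notMem hξ, ← ofReal_norm, norm_mul, norm_e, one_mul, ofReal_norm]
    rw [h1, ← eLpNorm_two_sq, ← Lp.enorm_def, ← ofReal_norm, Lp.norm_fourier_eq, ofReal_norm,
      Lp.enorm_def, ← lintegral_glue (θ := θ) (ψ := ψ), ← eLpNorm_two_sq]
    congr 1
    exact eLpNorm_congr_ae (memLp_glue (Lp.memLp f)).coeFn_toLp
  have hdisc : ENNReal.ofReal (1 / (α - 1)) *
      ∑' n : ℤ, ‖expansion α β θ ψ f (ψ / (α - 1) + n / (α - 1))‖ₑ ^ 2 =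
      ∫⁻ x in Ioo 1 α, ‖f x‖ₑ ^ 2 := by
    have h1 := hasSum_norm_innerCoeff_sq hα ψ f
    have h2 : Integrable (fun x => ‖f x‖ ^ 2) (volume.restrict (Ioo 1 α)) :=
      ((Lp.memLp f).mono_measure
        (Measure.restrict_mono Ioo_subset_Omega le_rfl)).integrable_norm_pow two_ne_zero
    have h3 : ∀ z : ℂ, ‖z‖ₑ ^ 2 = ENNReal.ofReal (‖z‖ ^ 2) := fun z => by
      rw [← ofReal_norm, ENNReal.ofReal_pow (norm_nonneg z)]
    simp_rw [h3]
    rw [← ofReal_integral_eq_lintegral_ofReal h2 (ae_of_all _ fun x => by positivity), ← h1.tsum_eq,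
      ENNReal.ofReal_tsum_of_nonneg (fun n => by positivity) h1.summable, ← ENNReal.tsum_mul_left]
    refine tsum_congr fun n => ?_
    rw [expansion_of_mem ⟨n, rfl⟩, ENNReal.ofReal_mul (by positivity)]
  have h : eLpNorm (expansion α β θ ψ f) 2 (spectralMeasure α ψ) ^ 2 =
      eLpNorm f 2 (volume.restrict (Omega α β)) ^ 2 := by
    rw [eLpNorm_two_sq, eLpNorm_two_sq, lintegral_spectralMeasure, hcont, hdisc,
      lintegral_Omega hα hβ]
    ring
  exact (ENNReal.pow_right_strictMono two_ne_zero).injective h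

theorem aestronglyMeasurable_expansion (f : L2Omega α β) :
    AEStronglyMeasurable (expansion α β θ ψ f) (spectralMeasure α ψ) := by
  classical
  have hL := (Lp.stronglyMeasurable
    (𝓕 (glueLp α β θ ψ f) : Lp ℂ 2 (volume : Measure ℝ))).measurable
  have h1 : Measurable fun ξ : ℝ => e (-β * ξ) *
      (𝓕 (glueLp α β θ ψ f) : Lp ℂ 2 (volume : Measure ℝ)) ξ :=
    (by fun_prop : Continuous fun ξ : ℝ => e (-β * ξ)).measurable.mul hL
  have h2 : Measurable fun ξ : ℝ => innerCoeff α β ξ f := by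
    refine (StronglyMeasurable.integral_prod_right' (f := fun p : ℝ × ℝ => e (-p.1 * p.2) * f p.2)
      (ν := volume.restrict (Ioo 1 α)) ?_).measurable
    exact ((by fun_prop : Continuous fun p : ℝ × ℝ => e (-p.1 * p.2)).stronglyMeasurable).mul
      ((Lp.stronglyMeasurable f).comp_measurable measurable_snd)
  exact (Measurable.ite (measurableSet_boundStates α ψ) h2 h1).aestronglyMeasurable

theorem memLp_expansion (hα : 1 < α) (hβ : α < β) (f : L2Omega α β) :
    MemLp (expansion α β θ ψ f) 2 (spectralMeasure α ψ) :=
  ⟨aestronglyMeasurable_expansion f, by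
    rw [eLpNorm_expansion hα hβ]
    exact (Lp.memLp f).2⟩

theorem expansion_add (hα : 1 < α) (f g : L2Omega α β) :
    expansion α β θ ψ (f + g) =ᵐ[spectralMeasure α ψ]
      expansion α β θ ψ f + expansion α β θ ψ g := by
  refine (ae_spectralMeasure_iff hα ψ).mpr ⟨?_, fun ξ hξ => ?_⟩
  · filter_upwards [ae_notMem_boundStates α ψ,
      Lp.coeFn_add (𝓕 (glueLp α β θ ψ f)) (𝓕 (glueLp α β θ ψ g))] with ξ hξ h1
    rw [Pi.add_apply, expansion_of_notMem hξ, expansion_of_notMem hξ, expansion_of_notMem hξ,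
      map_add, FourierTransform.fourier_add, h1, Pi.add_apply, mul_add]
  · rw [Pi.add_apply, expansion_of_mem hξ, expansion_of_mem hξ, expansion_of_mem hξ, map_add]

theorem expansion_smul (hα : 1 < α) (c : ℂ) (f : L2Omega α β) :
    expansion α β θ ψ (c • f) =ᵐ[spectralMeasure α ψ] c • expansion α β θ ψ f := by
  refine (ae_spectralMeasure_iff hα ψ).mpr ⟨?_, fun ξ hξ => ?_⟩
  · filter_upwards [ae_notMem_boundStates α ψ,
      Lp.coeFn_smul c (𝓕 (glueLp α β θ ψ f))] with ξ hξ h1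
    rw [Pi.smul_apply, expansion_of_notMem hξ, expansion_of_notMem hξ, map_smul,
      FourierTransform.fourier_smul, h1, Pi.smul_apply, smul_eq_mul, smul_eq_mul]
    ring
  · rw [Pi.smul_apply, expansion_of_mem hξ, expansion_of_mem hξ, map_smul]

/-- The expansion in generalized eigenfunctions as an isometry. -/
def expansionIsometry (hα : 1 < α) (hβ : α < β) (θ ψ : ℝ) :
    L2Omega α β →ₗᵢ[ℂ] Lp ℂ 2 (spectralMeasure α ψ) where
  toFun f := (memLp_expansion (θ := θ) hα hβ f).toLp _
  map_add' f g := by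
    rw [← MemLp.toLp_add]
    exact MemLp.toLp_congr _ _ (expansion_add hα f g)
  map_smul' c f := by
    rw [RingHom.id_apply, ← MemLp.toLp_const_smul]
    exact MemLp.toLp_congr _ _ (expansion_smul hα c f)
  norm_map' f := by
    change ‖(memLp_expansion (θ := θ) hα hβ f).toLp _‖ = ‖f‖
    rw [Lp.norm_toLp, eLpNorm_expansion hα hβ, Lp.norm_def]

theorem coeFn_expansionIsometry (hα : 1 < α) (hβ : α < β) (f : L2Omega α β) :
    expansionIsometry hα hβ θ ψ f =ᵐ[spectralMeasure α ψ] expansion α β θ ψ f :=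
  (memLp_expansion hα hβ f).coeFn_toLp

/-! ### The generalized eigenfunctions as integral kernels -/

theorem planeWave_of_mem_Iio (hβ : 0 ≤ β) (a b c : ℂ) (ξ : ℝ) {x : ℝ} (hx : x < 0) :
    planeWave α β a b c ξ x = a * e (ξ * x) := by
  simp [planeWave, hx, show ¬ 1 < x by linarith, show ¬ β < x by linarith]

theorem planeWave_of_mem_Ioo (hβ : α < β) (a b c : ℂ) (ξ : ℝ) {x : ℝ} (hx : x ∈ Ioo 1 α) :
    planeWave α β a b c ξ x = b * e (ξ * x) := by
  simp [planeWave, hx.1, hx.2, show ¬ x < 0 by linarith [hx.1], show ¬ β < x by linarith [hx.2]]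

theorem planeWave_of_mem_Ioi (hα : 1 < α) (hβ : α < β) (a b c : ℂ) (ξ : ℝ) {x : ℝ} (hx : β < x) :
    planeWave α β a b c ξ x = c * e (ξ * x) := by
  simp [planeWave, hx, show ¬ x < 0 by linarith, show ¬ x < α by linarith]

theorem wave_eq_planeWave_of_mem (hα : 1 < α) (hβ : α < β) {ξ : ℝ} (hξ : ξ ∈ boundStates α ψ)
    {x : ℝ} (hx : x ∈ Omega α β) : wave α β θ ψ ξ x = planeWave α β 0 1 0 ξ x := by
  rw [wave, waveAmplitude, if_pos hξ]
  rcases hx with (hx | hx) | hx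
  · rw [planeWave_of_mem_Iio (by linarith) _ _ _ _ hx,
      if_neg fun h => by linarith [h.1, mem_Iio.mp hx]]
  · rw [planeWave_of_mem_Ioo hβ _ _ _ _ hx, if_pos ⟨hx.1.le, hx.2.le⟩]
  · rw [planeWave_of_mem_Ioi hα hβ _ _ _ _ hx, if_neg fun h => by linarith [h.2, mem_Ioi.mp hx]]

theorem wave_eq_planeWave_of_notMem (hα : 1 < α) (hβ : α < β) {ξ : ℝ} (hξ : ξ ∉ boundStates α ψ)
    {x : ℝ} (hx : x ∈ Omega α β) :
    wave α β θ ψ ξ x = planeWave α β (-e (θ - ψ + β * ξ)) 0 1 ξ x := by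
  rw [wave, waveAmplitude, if_neg hξ]
  rcases hx with (hx | hx) | hx
  · rw [planeWave_of_mem_Iio (by linarith) _ _ _ _ hx, if_pos (le_of_lt hx)]
  · rw [planeWave_of_mem_Ioo hβ _ _ _ _ hx, if_neg (by linarith [hx.1]),
      if_neg (by linarith [hx.2])]
  · have hx' : β < x := hx
    rw [planeWave_of_mem_Ioi hα hβ _ _ _ _ hx, if_neg (by linarith), if_pos hx'.le]

theorem measurable_planeWave (a b c : ℂ) (ξ : ℝ) : Measurable (planeWave α β a b c ξ) := by
  unfold planeWave
  refine Measurable.mul ?_ (by fun_prop : Continuous fun x => e (ξ * x)).measurable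
  exact (((measurable_one.indicator measurableSet_Iio).const_mul _).add
    ((measurable_one.indicator measurableSet_Ioo).const_mul _)).add
    ((measurable_one.indicator measurableSet_Ioi).const_mul _)

theorem norm_planeWave_le (a b c : ℂ) (ξ x : ℝ) :
    ‖planeWave α β a b c ξ x‖ ≤ ‖a‖ + ‖b‖ + ‖c‖ := by
  have h : ∀ (z : ℂ) (s : Set ℝ), ‖z * s.indicator 1 x‖ ≤ ‖z‖ := by
    intro z s
    by_cases hx : x ∈ s <;> simp [hx]
  rw [planeWave, norm_mul, norm_e, mul_one]
  exact (norm_add_le _ _).trans (add_le_add ((norm_add_le _ _).trans (add_le_add (h _ _) (h _ _)))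
    (h _ _))

theorem integrable_conj_planeWave_mul (a b c : ℂ) (ξ : ℝ) {f : ℝ → ℂ}
    (hf : IntegrableOn f (Omega α β)) :
    IntegrableOn (fun x => conj (planeWave α β a b c ξ x) * f x) (Omega α β) := by
  refine Integrable.bdd_mul (c := ‖a‖ + ‖b‖ + ‖c‖) hf
    (Complex.continuous_conj.measurable.comp
      (measurable_planeWave a b c ξ)).aestronglyMeasurable (ae_of_all _ fun x => ?_)
  rw [RCLike.norm_conj]
  exact norm_planeWave_le a b c ξ x

theorem integral_conj_planeWave_bound (hα : 1 < α) (hβ : α < β) (ξ : ℝ) (f : L2Omega α β) :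
    ∫ x in Omega α β, conj (planeWave α β 0 1 0 ξ x) * f x = innerCoeff α β ξ f := by
  rw [innerCoeff_apply]
  have h1 : ∀ x ∈ Omega α β, conj (planeWave α β 0 1 0 ξ x) * f x =
      (Ioo 1 α).indicator (fun x => e (-ξ * x) * f x) x := by
    intro x hx
    rcases hx with (hx | hx) | hx
    · rw [planeWave_of_mem_Iio (by linarith) _ _ _ _ hx, indicator_of_notMem
        fun h => by linarith [h.1, mem_Iio.mp hx]]
      simp
    · rw [planeWave_of_mem_Ioo hβ _ _ _ _ hx, indicator_of_mem hx, one_mul, conj_e, neg_mul]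
    · rw [planeWave_of_mem_Ioi hα hβ _ _ _ _ hx, indicator_of_notMem
        fun h => by linarith [h.2, mem_Ioi.mp hx]]
      simp
  rw [setIntegral_congr_fun (measurableSet_Omega α β) h1, setIntegral_indicator measurableSet_Ioo,
    inter_eq_self_of_subset_right Ioo_subset_Omega]

/-- Conjugation turns `e(θ - ψ + βξ)` into `e(-βξ) e(ψ - θ)`, whose second factor is the glueing
factor on the left half-line; on the right half-line substitute `x = y + β`. -/
theorem integral_conj_planeWave_scattering (hα : 1 < α) (hβ : α < β) (ξ : ℝ) {f : ℝ → ℂ}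
    (hf : IntegrableOn f (Omega α β)) :
    ∫ x in Omega α β, conj (planeWave α β (-e (θ - ψ + β * ξ)) 0 1 ξ x) * f x =
      e (-β * ξ) * 𝓕 (glue β θ ψ f) ξ := by
  rw [integral_Omega hα hβ (integrable_conj_planeWave_mul _ _ _ _ hf)]
  have hg : Integrable (glue β θ ψ f) volume :=
    memLp_one_iff_integrable.mp (memLp_glue (memLp_one_iff_integrable.mpr hf))
  have h1 : 𝓕 (glue β θ ψ f) ξ = ∫ y, e (-ξ * y) * glue β θ ψ f y := by
    rw [Real.fourier_real_eq_integral_exp_smul]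
    refine integral_congr_ae (ae_of_all _ fun y => ?_)
    simp only [smul_eq_mul]
    rw [e_eq_expI]
    congr 4
    ring
  have hgi : Integrable (fun y => e (-ξ * y) * glue β θ ψ f y) volume := by
    rw [← integrableOn_univ] at hg ⊢
    exact integrableOn_e_mul _ hg
  rw [h1, ← integral_add_compl (measurableSet_Iic (a := (0 : ℝ))) hgi, compl_Iic,
    integral_Iic_eq_integral_Iio, mul_add, ← integral_const_mul, ← integral_const_mul]
  have hl : ∫ x in Iio 0, conj (planeWave α β (-e (θ - ψ + β * ξ)) 0 1 ξ x) * f x =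
      ∫ y in Iio 0, e (-β * ξ) * (e (-ξ * y) * glue β θ ψ f y) := by
    refine setIntegral_congr_fun measurableSet_Iio fun x (hx : x < 0) => ?_
    rw [planeWave_of_mem_Iio (by linarith) _ _ _ _ hx, glue, if_neg hx.not_gt, map_mul, map_neg,
      conj_e, conj_e, show -(θ - ψ + β * ξ) = -β * ξ + (ψ - θ) by ring, e_add, neg_mul ξ]
    ring
  have hm : ∫ x in Ioo 1 α, conj (planeWave α β (-e (θ - ψ + β * ξ)) 0 1 ξ x) * f x = 0 := by
    rw [setIntegral_congr_fun (g := fun _ => (0 : ℂ)) measurableSet_Ioo fun x hx => ?_]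
    · simp
    · simp only
      rw [planeWave_of_mem_Ioo hβ _ _ _ _ hx]
      simp
  have hr : ∫ x in Ioi β, conj (planeWave α β (-e (θ - ψ + β * ξ)) 0 1 ξ x) * f x =
      ∫ y in Ioi 0, e (-β * ξ) * (e (-ξ * y) * glue β θ ψ f y) := by
    rw [← (measurePreserving_add_Ioi β).integral_comp (measurableEmbedding_addRight β)]
    refine setIntegral_congr_fun measurableSet_Ioi fun y (hy : 0 < y) => ?_
    rw [planeWave_of_mem_Ioi hα hβ _ _ _ _ (by linarith), glue, if_pos hy, one_mul, conj_e,
      ← mul_assoc, ← e_add]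
    congr 2
    ring
  rw [hl, hm, hr, add_zero]

theorem expansion_eq_integral_bound (hα : 1 < α) (hβ : α < β) (f : L2Omega α β) {ξ : ℝ}
    (hξ : ξ ∈ boundStates α ψ) :
    expansion α β θ ψ f ξ = ∫ x in Omega α β, conj (planeWave α β 0 1 0 ξ x) * f x := by
  rw [expansion_of_mem hξ, integral_conj_planeWave_bound hα hβ]

theorem expansion_eq_integral_scattering (hα : 1 < α) (hβ : α < β) (f : L2Omega α β)
    (hf : Integrable f (volume.restrict (Omega α β))) :
    ∀ᵐ ξ : ℝ, expansion α β θ ψ f ξ =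
      ∫ x in Omega α β, conj (planeWave α β (-e (θ - ψ + β * ξ)) 0 1 ξ x) * f x := by
  have hg : Integrable (glue β θ ψ f) volume :=
    memLp_one_iff_integrable.mp (memLp_glue (memLp_one_iff_integrable.mpr hf))
  filter_upwards [ae_notMem_boundStates α ψ,
    coeFn_fourier_toLp (memLp_glue (θ := θ) (ψ := ψ) (Lp.memLp f)) hg] with ξ hξ h1
  rw [expansion_of_notMem hξ, integral_conj_planeWave_scattering hα hβ ξ hf, ← h1]
  rfl

/-! ### Surjectivity of the expansion -/

/-- Orthogonality of bound states: for `μ, ξ` in `Λ` the exponential of frequency `μ - ξ` takes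
equal values at `1` and `α`, so its integral vanishes unless the frequency is zero. -/
theorem innerCoeff_of_ae_eq_planeWave (hα : 1 < α) (hβ : α < β) {μ ξ : ℝ}
    (hμ : μ ∈ boundStates α ψ) (hξ : ξ ∈ boundStates α ψ) (b : ℂ) {f : L2Omega α β}
    (hf : f =ᵐ[volume.restrict (Omega α β)] planeWave α β 0 b 0 μ) :
    innerCoeff α β ξ f = if ξ = μ then (α - 1) * b else 0 := by
  have h1 : innerCoeff α β ξ f = (∫ x in 1..α, e ((μ - ξ) * x)) * b := by
    rw [innerCoeff_apply, intervalIntegral.integral_of_le hα.le, integral_Ioc_eq_integral_Ioo,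
      ← integral_mul_const]
    refine integral_congr_ae ?_
    filter_upwards [ae_restrict_of_ae_restrict_of_subset Ioo_subset_Omega hf,
      ae_restrict_mem measurableSet_Ioo] with x hx hx'
    rw [hx, planeWave_of_mem_Ioo hβ _ _ _ _ hx', sub_eq_add_neg, add_mul, e_add]
    ring
  rw [h1]
  split_ifs with h
  · subst h
    simp [e_zero]
  · have h2 := integral_e_mul (μ - ξ) 1 α
    have h3 : e ((μ - ξ) * α) = e ((μ - ξ) * 1) := by
      have h4 := (mem_boundStates_iff hα μ).mp hμ
      rw [← (mem_boundStates_iff hα ξ).mp hξ] at h4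
      rw [show (μ - ξ) * α = (μ - ξ) * 1 + (μ * (α - 1) + -(ξ * (α - 1))) by ring, e_add, e_add, h4,
        e_mul_e_neg, mul_one]
    rw [h3, sub_self, mul_eq_zero] at h2
    have h5 : ((μ - ξ : ℝ) : ℂ) ≠ 0 := by
      exact_mod_cast sub_ne_zero.mpr (Ne.symm h)
    rw [h2.resolve_left (mul_ne_zero Complex.two_pi_I_ne_zero h5), zero_mul]

/-- A function supported in `(1, α)` glues to zero, so only its coefficients at the atoms remain,
and orthogonality leaves one of them. -/
theorem expansion_of_ae_eq_planeWave (hα : 1 < α) (hβ : α < β) {μ : ℝ}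
    (hμ : μ ∈ boundStates α ψ) (b : ℂ) {f : L2Omega α β}
    (hf : f =ᵐ[volume.restrict (Omega α β)] planeWave α β 0 b 0 μ) :
    expansion α β θ ψ f =ᵐ[spectralMeasure α ψ]
      ({μ} : Set ℝ).indicator fun _ => (α - 1) * b := by
  refine (ae_spectralMeasure_iff hα ψ).mpr ⟨?_, fun ξ hξ => ?_⟩
  · have hglue : glueLp α β θ ψ f = 0 := by
      refine Lp.ext ((memLp_glue (Lp.memLp f)).coeFn_toLp.trans ?_)
      filter_upwards [glue_congr_ae (θ := θ) (ψ := ψ) hf, Lp.coeFn_zero ℂ 2 (volume : Measure ℝ),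
        ae_ne_zero] with y h1 h2 h3
      rw [h1, h2, glue]
      split_ifs with h
      · rw [planeWave_of_mem_Ioi hα hβ _ _ _ _ (by linarith), zero_mul, Pi.zero_apply]
      · rw [planeWave_of_mem_Iio (by linarith) _ _ _ _ (lt_of_le_of_ne (not_lt.mp h) h3), zero_mul,
          mul_zero, Pi.zero_apply]
    filter_upwards [ae_notMem_boundStates α ψ, Lp.coeFn_zero ℂ 2 (volume : Measure ℝ)]
      with ξ hξ h2
    have h0 : 𝓕 (0 : Lp ℂ 2 (volume : Measure ℝ)) = 0 :=
      (Lp.fourierTransformₗᵢ ℝ ℂ).map_zero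
    rw [expansion_of_notMem hξ, hglue, h0, h2, Pi.zero_apply, mul_zero, indicator_of_notMem]
    rintro rfl
    exact hξ hμ
  · rw [expansion_of_mem hξ, innerCoeff_of_ae_eq_planeWave hα hβ hμ hξ b hf]
    by_cases h : ξ = μ <;> simp [h]

theorem memLp_planeWave_bound (hβ : α < β) (b : ℂ) (μ : ℝ) :
    MemLp (planeWave α β 0 b 0 μ) 2 (volume.restrict (Omega α β)) := by
  have h1 : planeWave α β 0 b 0 μ = (Ioo 1 α).indicator fun x => b * e (μ * x) := by
    ext x
    by_cases h : x ∈ Ioo 1 α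
    · rw [indicator_of_mem h, planeWave_of_mem_Ioo hβ _ _ _ _ h]
    · rw [indicator_of_notMem h, planeWave, indicator_of_notMem h]
      simp
  rw [h1, memLp_indicator_iff_restrict measurableSet_Ioo,
    Measure.restrict_restrict measurableSet_Ioo, inter_eq_self_of_subset_left Ioo_subset_Omega]
  refine MemLp.of_bound (by fun_prop : Continuous fun x => b * e (μ * x)).aestronglyMeasurable ‖b‖
    (ae_of_all _ fun x => ?_)
  rw [norm_mul, norm_e, mul_one]

/-- The inverse of the glueing map. -/
def unglue (β θ ψ : ℝ) (q : ℝ → ℂ) : ℝ → ℂ :=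
  (Ioi β).indicator (fun x => q (x + -β)) + (Iio 0).indicator fun x => -e (θ - ψ) * q x

theorem memLp_unglue {q : ℝ → ℂ} (hq : MemLp q 2 volume) : MemLp (unglue β θ ψ q) 2 volume :=
  MemLp.add ((hq.comp_measurePreserving (measurePreserving_add_right volume (-β))).indicator
    measurableSet_Ioi) ((hq.const_mul _).indicator measurableSet_Iio)

theorem glue_unglue (hβ : 0 < β) (q : ℝ → ℂ) :
    glue β θ ψ (unglue β θ ψ q) =ᵐ[volume] q := by
  filter_upwards [ae_ne_zero] with y hy
  rw [glue, unglue, Pi.add_apply, Pi.add_apply]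
  split_ifs with h
  · rw [indicator_of_mem (show y + β ∈ Ioi β from lt_add_of_pos_left β h), indicator_of_notMem
      (show y + β ∉ Iio 0 from notMem_Iio.mpr (by linarith))]
    simp
  · have hy' : y < 0 := lt_of_le_of_ne (not_lt.mp h) hy
    rw [indicator_of_notMem (show y ∉ Ioi β from notMem_Ioi.mpr (by linarith)), indicator_of_mem (show y ∈ Iio 0 from hy'),
      zero_add, show θ - ψ = -(ψ - θ) by ring]
    linear_combination q y * e_mul_e_neg (ψ - θ)

/-- Every square integrable function is the scattering part of an expansion without bound state
part. -/
theorem exists_expansion_eq (hα : 1 < α) (hβ : α < β) {v : ℝ → ℂ} (hv : MemLp v 2 volume) :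
    ∃ f : L2Omega α β, expansion α β θ ψ f =ᵐ[spectralMeasure α ψ]
      (boundStates α ψ)ᶜ.indicator v := by
  -- The factor `e(βξ)` compensates the phase `e(-βξ)` in `expansion`.
  have hq : MemLp (fun ξ => e (β * ξ) * v ξ) 2 volume :=
    hv.of_le ((by fun_prop : Continuous fun ξ => e (β * ξ)).aestronglyMeasurable.mul
      hv.aestronglyMeasurable) (ae_of_all _ fun x => by
        rw [norm_mul, norm_e, one_mul])
  set q : Lp ℂ 2 (volume : Measure ℝ) := 𝓕⁻ (hq.toLp _) with hqd
  have hu : MemLp (unglue β θ ψ q) 2 (volume.restrict (Omega α β)) :=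
    (memLp_unglue (Lp.memLp q)).mono_measure Measure.restrict_le_self
  have hglue : glueLp α β θ ψ (hu.toLp _) = q := by
    refine Lp.ext ((memLp_glue (Lp.memLp (hu.toLp _))).coeFn_toLp.trans ?_)
    exact (glue_congr_ae hu.coeFn_toLp).trans (glue_unglue (by linarith) _)
  refine ⟨hu.toLp _, (ae_spectralMeasure_iff hα ψ).mpr ⟨?_, fun ξ hξ => ?_⟩⟩
  · filter_upwards [ae_notMem_boundStates α ψ, hq.coeFn_toLp] with ξ hξ h1
    rw [expansion_of_notMem hξ, hglue, hqd, FourierTransform.fourier_fourierInv_eq, h1,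
      indicator_of_mem (show ξ ∈ (boundStates α ψ)ᶜ from hξ), ← mul_assoc, neg_mul, e_neg_mul_e,
      one_mul]
  · rw [expansion_of_mem hξ, indicator_of_notMem (by simpa using hξ), innerCoeff_apply]
    refine integral_eq_zero_of_ae ?_
    filter_upwards [ae_restrict_of_ae_restrict_of_subset Ioo_subset_Omega hu.coeFn_toLp,
      ae_restrict_mem measurableSet_Ioo] with x hx hx'
    rw [hx, unglue, Pi.add_apply, indicator_of_notMem (show x ∉ Ioi β from notMem_Ioi.mpr (by linarith [hx'.2])),
      indicator_of_notMem (show x ∉ Iio 0 from notMem_Iio.mpr (by linarith [hx'.1]))]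
    simp

/-- The range of an isometry from a complete space is closed, so it suffices that a `v` orthogonal
to it vanishes. Functions on the half-lines detect `v` off `Λ`, and the bound states detect it at
each atom. -/
theorem surjective_expansionIsometry (hα : 1 < α) (hβ : α < β) :
    Function.Surjective (expansionIsometry hα hβ θ ψ) := by
  set L := expansionIsometry hα hβ θ ψ with hL
  have hclosed : IsClosed (LinearMap.range L.toLinearMap : Set (Lp ℂ 2 (spectralMeasure α ψ))) :=
    L.isometry.isClosedEmbedding.isClosed_range
  have : CompleteSpace (LinearMap.range L.toLinearMap) := hclosed.completeSpace_coe
  suffices h : LinearMap.range L.toLinearMap = ⊤ from LinearMap.range_eq_top.mp h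
  rw [← Submodule.orthogonal_eq_bot_iff, Submodule.eq_bot_iff]
  intro v hv
  have hv' : ∀ f, inner ℂ (L f) v = 0 := fun f => hv _ ⟨f, rfl⟩
  have hvol : MemLp v 2 (volume : Measure ℝ) :=
    (Lp.memLp v).mono_measure (volume_le_spectralMeasure α ψ)
  -- Taking `v` itself as the scattering part turns the orthogonality relation into `∫ |v|² = 0`
  -- over the complement of `Λ`.
  obtain ⟨f, hf⟩ := exists_expansion_eq (θ := θ) (ψ := ψ) hα hβ hvol
  have hLf := (coeFn_expansionIsometry hα hβ f).trans hf
  have h1 : ∀ᵐ ξ ∂(spectralMeasure α ψ), ξ ∉ boundStates α ψ → v ξ = 0 := by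
    have h2 := hv' f
    rw [L2.inner_def] at h2
    have h3 : (fun ξ => inner ℂ (L f ξ) (v ξ)) =ᵐ[spectralMeasure α ψ]
        fun ξ => (((boundStates α ψ)ᶜ.indicator (fun ξ => ‖v ξ‖ ^ 2) ξ : ℝ) : ℂ) := by
      filter_upwards [hLf] with ξ hξ
      rw [hξ]
      by_cases h : ξ ∈ (boundStates α ψ)ᶜ
      · rw [indicator_of_mem h, indicator_of_mem h, inner_self_eq_norm_sq_to_K]
        norm_cast
      · rw [indicator_of_notMem h, indicator_of_notMem h, inner_zero_left, Complex.ofReal_zero]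
    rw [integral_congr_ae h3, integral_complex_ofReal] at h2
    have h4 : Integrable ((boundStates α ψ)ᶜ.indicator fun ξ => ‖v ξ‖ ^ 2)
        (spectralMeasure α ψ) :=
      ((Lp.memLp v).integrable_norm_pow two_ne_zero).indicator
        (measurableSet_boundStates α ψ).compl
    have h5 := (integral_eq_zero_iff_of_nonneg (fun ξ => indicator_nonneg
      (fun ξ _ => by positivity) ξ) h4).mp (by exact_mod_cast h2)
    filter_upwards [h5] with ξ hξ hξ'
    rw [indicator_of_mem (show ξ ∈ (boundStates α ψ)ᶜ from hξ')] at hξ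
    simpa using hξ
  have h6 : ∀ μ ∈ boundStates α ψ, v μ = 0 := by
    intro μ hμ
    set f0 : L2Omega α β := (memLp_planeWave_bound hβ 1 μ).toLp _ with hf0
    have h7 := expansion_of_ae_eq_planeWave (θ := θ) hα hβ hμ 1
      (memLp_planeWave_bound hβ 1 μ).coeFn_toLp
    have h8 := hv' f0
    rw [L2.inner_def] at h8
    have h9 : (fun ξ => inner ℂ (L f0 ξ) (v ξ)) =ᵐ[spectralMeasure α ψ]
        ({μ} : Set ℝ).indicator fun _ => (α - 1) * v μ := by
      filter_upwards [(coeFn_expansionIsometry hα hβ f0).trans h7] with ξ hξ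
      rw [hξ]
      by_cases h : ξ = μ
      · subst h
        rw [indicator_of_mem (mem_singleton ξ), indicator_of_mem (mem_singleton ξ),
          RCLike.inner_apply, mul_one]
        simp [mul_comm]
      · rw [indicator_of_notMem (mem_singleton_iff.not.mpr h),
          indicator_of_notMem (mem_singleton_iff.not.mpr h), inner_zero_left]
    rw [integral_congr_ae h9, integral_indicator_const _ (measurableSet_singleton μ),
      measureReal_def, spectralMeasure_singleton hα hμ, ENNReal.toReal_ofReal
        (one_div_nonneg.mpr (by linarith)), smul_eq_zero] at h8
    have h10 : α - 1 ≠ 0 := by linarith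
    have h11 : (α : ℂ) - 1 ≠ 0 := by exact_mod_cast h10
    simpa [h10, h11] using h8
  refine Lp.ext ?_
  filter_upwards [h1, Lp.coeFn_zero ℂ 2 (spectralMeasure α ψ)] with ξ hξ h0
  rw [h0, Pi.zero_apply]
  by_cases h : ξ ∈ boundStates α ψ
  · exact h6 ξ h
  · exact hξ h

/-- The expansion in generalized eigenfunctions as a unitary operator. -/
def expansionEquiv (hα : 1 < α) (hβ : α < β) (θ ψ : ℝ) :
    L2Omega α β ≃ₗᵢ[ℂ] Lp ℂ 2 (spectralMeasure α ψ) :=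
  LinearIsometryEquiv.ofSurjective (expansionIsometry hα hβ θ ψ)
    (surjective_expansionIsometry hα hβ)

theorem coeFn_expansionEquiv (hα : 1 < α) (hβ : α < β) (f : L2Omega α β) :
    expansionEquiv hα hβ θ ψ f =ᵐ[spectralMeasure α ψ] expansion α β θ ψ f :=
  coeFn_expansionIsometry hα hβ f

theorem expansionEquiv_bound (hα : 1 < α) (hβ : α < β) (f : L2Omega α β) :
    ∀ ξ ∈ boundStates α ψ, expansionEquiv hα hβ θ ψ f ξ =
      ∫ x in Omega α β, conj (planeWave α β 0 1 0 ξ x) * f x := fun ξ hξ => by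
  rw [((ae_spectralMeasure_iff hα ψ).mp (coeFn_expansionEquiv hα hβ f)).2 ξ hξ,
    expansion_eq_integral_bound hα hβ f hξ]

theorem expansionEquiv_scattering (hα : 1 < α) (hβ : α < β) (f : L2Omega α β)
    (hf : Integrable f (volume.restrict (Omega α β))) :
    ∀ᵐ ξ : ℝ, expansionEquiv hα hβ θ ψ f ξ =
      ∫ x in Omega α β, conj (planeWave α β (-e (θ - ψ + β * ξ)) 0 1 ξ x) * f x := by
  filter_upwards [((ae_spectralMeasure_iff hα ψ).mp
    (coeFn_expansionEquiv (θ := θ) hα hβ f)).1,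
    expansion_eq_integral_scattering hα hβ f hf] with ξ h1 h2
  rw [h1, h2]

theorem isWaveTransform_expansionEquiv (hα : 1 < α) (hβ : α < β) :
    IsWaveTransform α β θ ψ (expansionEquiv hα hβ θ ψ) := by
  intro f hf
  refine (ae_spectralMeasure_iff hα ψ).mpr ⟨?_, fun ξ hξ => ?_⟩
  · filter_upwards [ae_notMem_boundStates α ψ, expansionEquiv_scattering hα hβ f hf] with ξ hξ h1
    rw [h1]
    exact setIntegral_congr_fun (measurableSet_Omega α β) fun x hx => by
      simp only [wave_eq_planeWave_of_notMem hα hβ hξ hx]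
  · rw [expansionEquiv_bound hα hβ f ξ hξ]
    exact setIntegral_congr_fun (measurableSet_Omega α β) fun x hx => by
      simp only [wave_eq_planeWave_of_mem hα hβ hξ hx]

/-! ### Plane waves as functionals on test functions -/

theorem integrableOn_planeWave (a b c : ℂ) (lam R : ℝ) :
    IntegrableOn (planeWave α β a b c lam) (Omega α β ∩ Icc (-R) R) := by
  have hfin : volume (Omega α β ∩ Icc (-R) R) ≠ ⊤ :=
    ((measure_mono inter_subset_right).trans_lt measure_Icc_lt_top).ne
  exact Measure.integrableOn_of_bounded hfin (measurable_planeWave a b c lam).aestronglyMeasurable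
    (ae_of_all _ fun x => norm_planeWave_le a b c lam x)

theorem integrable_conj_mul_planeWave {η : ℝ → ℂ} (hη : Continuous η) (hη' : HasCompactSupport η)
    (a b c : ℂ) (lam : ℝ) : Integrable (fun x => conj (η x) * planeWave α β a b c lam x) := by
  have h1 : Integrable fun x => conj (η x) :=
    (Complex.continuous_conj.comp hη).integrable_of_hasCompactSupport
      (hη'.comp_left (g := conj) (map_zero _))
  exact h1.mul_bdd (measurable_planeWave a b c lam).aestronglyMeasurable
    (ae_of_all _ fun x => norm_planeWave_le a b c lam x)

/-- The antilinear functional on test functions given by a plane wave. -/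
def planeWaveFunctional (α β : ℝ) (B : Matrix (Fin 2) (Fin 2) ℂ) (a b c : ℂ) (lam : ℝ) :
    testSpace α β B →ₛₗ[starRingEnd ℂ] ℂ where
  toFun η := ∫ x in Omega α β, conj ((η : ℝ → ℂ) x) * planeWave α β a b c lam x
  map_add' η ζ := by
    rw [← integral_add
      (integrable_conj_mul_planeWave η.2.1.continuous η.2.2.1 a b c lam).integrableOn
      (integrable_conj_mul_planeWave ζ.2.1.continuous ζ.2.2.1 a b c lam).integrableOn]
    congr 1
    ext x
    simp [add_mul]
  map_smul' z η := by
    rw [smul_eq_mul, ← integral_const_mul]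
    congr 1
    ext x
    simp [mul_assoc]

theorem isDistribution_planeWaveFunctional (B : Matrix (Fin 2) (Fin 2) ℂ) (a b c : ℂ)
    (lam : ℝ) : IsDistribution (planeWaveFunctional α β B a b c lam) := by
  intro R
  -- A plane wave is bounded by `‖a‖ + ‖b‖ + ‖c‖`, so the functional has order zero, with that bound
  -- times the length of the region as constant.
  refine ⟨0, (‖a‖ + ‖b‖ + ‖c‖) * volume.real (Omega α β ∩ Icc (-R) R), fun η M hη hM => ?_⟩
  have hfin : volume (Omega α β ∩ Icc (-R) R) < ⊤ :=
    (measure_mono inter_subset_right).trans_lt measure_Icc_lt_top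
  have h1 : planeWaveFunctional α β B a b c lam η =
      ∫ x in Omega α β ∩ Icc (-R) R, conj ((η : ℝ → ℂ) x) * planeWave α β a b c lam x := by
    change ∫ x in Omega α β, conj ((η : ℝ → ℂ) x) * planeWave α β a b c lam x = _
    refine setIntegral_eq_of_subset_of_forall_sdiff_eq_zero (measurableSet_Omega α β)
      inter_subset_left fun x hx => ?_
    have hx' : (η : ℝ → ℂ) x = 0 := by
      by_contra h
      exact hx.2 ⟨hx.1, hη (subset_tsupport _ h)⟩
    rw [hx', map_zero, zero_mul]
  rw [h1]
  refine (norm_setIntegral_le_of_norm_le_const (C := M * (‖a‖ + ‖b‖ + ‖c‖)) hfin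
    fun x hx => ?_).trans_eq (by ring)
  have hx' := hM 0 le_rfl x hx.1
  rw [iteratedDeriv_zero] at hx'
  rw [norm_mul, RCLike.norm_conj]
  exact mul_le_mul hx' (norm_planeWave_le a b c lam x) (norm_nonneg _)
    ((norm_nonneg _).trans hx')

/-- The plane wave on the closure of `Ω`. -/
def closedPlaneWave (α : ℝ) (a b c : ℂ) (lam x : ℝ) : ℂ :=
  -- The values in the gaps between the components are immaterial; what matters is that `0`, `1` and
  -- `α`, `β` get the amplitude of the adjacent component.
  (if x ≤ 0 then a else if x ≤ α then b else c) * e (lam * x)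

theorem closedPlaneWave_eq (hα : 1 < α) (hβ : α < β) (a b c : ℂ) (lam : ℝ) {x : ℝ}
    (hx : x ∈ Omega α β) : closedPlaneWave α a b c lam x = planeWave α β a b c lam x := by
  rw [closedPlaneWave]
  rcases hx with (hx | hx) | hx
  · rw [planeWave_of_mem_Iio (by linarith) _ _ _ _ hx, if_pos (le_of_lt hx)]
  · rw [planeWave_of_mem_Ioo hβ _ _ _ _ hx, if_neg (by linarith [hx.1]), if_pos hx.2.le]
  · have hx' : β < x := hx
    rw [planeWave_of_mem_Ioi hα hβ _ _ _ _ hx, if_neg (by linarith), if_neg (by linarith)]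

theorem contDiff_e_mul (lam : ℝ) : ContDiff ℝ ∞ fun x => e (lam * x) := by
  unfold e
  refine Complex.contDiff_exp.comp (contDiff_const.mul ?_)
  exact Complex.ofRealCLM.contDiff.comp (contDiff_const.mul contDiff_id)

theorem absolutelyContinuousOnInterval_e_mul (lam : ℝ) (z : ℂ) (s t : ℝ) :
    AbsolutelyContinuousOnInterval (fun x => z * e (lam * x)) s t :=
  ((contDiff_const.mul (contDiff_e_mul lam)).of_le
    (by exact_mod_cast le_top)).contDiffOn.absolutelyContinuousOnInterval

theorem isAC_closedPlaneWave (hα : 1 < α) (hβ : α < β) (a b c : ℂ) (lam : ℝ) :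
    IsAC α β (closedPlaneWave α a b c lam) := by
  refine ⟨fun s hs => (absolutelyContinuousOnInterval_e_mul lam a s 0).congr fun x hx => ?_,
    (absolutelyContinuousOnInterval_e_mul lam b 1 α).congr fun x hx => ?_,
    fun t ht => (absolutelyContinuousOnInterval_e_mul lam c β t).congr fun x hx => ?_⟩
  · rw [uIcc_of_le hs] at hx
    simp [closedPlaneWave, hx.2]
  · rw [uIcc_of_le hα.le] at hx
    simp [closedPlaneWave, hx.2, show ¬ x ≤ 0 by linarith [hx.1]]
  · rw [uIcc_of_le ht] at hx
    simp [closedPlaneWave, show ¬ x ≤ α by linarith [hx.1], show ¬ x ≤ 0 by linarith [hx.1]]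

theorem isAC_of_contDiff {η : ℝ → ℂ} (hη : ContDiff ℝ ∞ η) : IsAC α β η := by
  have h : ∀ s t, AbsolutelyContinuousOnInterval η s t := fun s t =>
    (hη.of_le (by exact_mod_cast le_top)).contDiffOn.absolutelyContinuousOnInterval
  exact ⟨fun s _ => h s 0, h 1 α, fun t _ => h β t⟩

theorem hasDerivAt_closedPlaneWave (hα : 1 < α) (hβ : α < β) (a b c : ℂ) (lam : ℝ) {x : ℝ}
    (hx : x ∈ Omega α β) : HasDerivAt (closedPlaneWave α a b c lam)
      (2 * Real.pi * Complex.I * lam * planeWave α β a b c lam x) x := by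
  have key : ∀ z : ℂ, closedPlaneWave α a b c lam =ᶠ[𝓝 x] (fun t => z * e (lam * t)) →
      HasDerivAt (closedPlaneWave α a b c lam)
      (2 * Real.pi * Complex.I * lam * planeWave α β a b c lam x) x := by
    intro z hz
    rw [← closedPlaneWave_eq hα hβ a b c lam hx, hz.eq_of_nhds]
    refine HasDerivAt.congr_of_eventuallyEq ?_ hz
    convert! (hasDerivAt_e_mul lam x).const_mul z using 1
    ring
  rcases hx with (hx | hx) | hx
  · refine key a ?_
    filter_upwards [isOpen_Iio.mem_nhds hx] with t ht
    simp [closedPlaneWave, le_of_lt (mem_Iio.mp ht)]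
  · refine key b ?_
    filter_upwards [isOpen_Ioo.mem_nhds hx] with t ht
    simp [closedPlaneWave, ht.2.le, show ¬ t ≤ 0 by linarith [ht.1]]
  · refine key c ?_
    filter_upwards [isOpen_Ioi.mem_nhds hx] with t ht
    rw [mem_Ioi] at ht
    simp [closedPlaneWave, show ¬ t ≤ α by linarith, show ¬ t ≤ 0 by linarith]

/-- Integration by parts against a plane wave. -/
theorem planeWaveFunctional_testMomentum (hα : 1 < α) (hβ : α < β)
    (B : Matrix (Fin 2) (Fin 2) ℂ) (a b c : ℂ) (lam : ℝ) (η : testSpace α β B) :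
    2 * Real.pi * Complex.I * (planeWaveFunctional α β B a b c lam (testMomentum η) -
      lam * planeWaveFunctional α β B a b c lam η) =
      conj ((η : ℝ → ℂ) β) * (c * e (lam * β)) + conj ((η : ℝ → ℂ) 1) * (b * e lam) -
        conj ((η : ℝ → ℂ) 0) * a - conj ((η : ℝ → ℂ) α) * (b * e (lam * α)) := by
  set u := planeWave α β a b c lam with hu
  set κ : ℂ := 2 * Real.pi * Complex.I with hκ
  have hκ0 : κ ≠ 0 := Complex.two_pi_I_ne_zero
  have hκc : conj κ = -κ := by simp [hκ, Complex.conj_ofNat]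
  have hdη := deriv_mem_testSpace η.2
  have i1 : IntegrableOn (fun x => conj ((η : ℝ → ℂ) x) * u x) (Omega α β) :=
    (integrable_conj_mul_planeWave η.2.1.continuous η.2.2.1 a b c lam).integrableOn
  have i2 : IntegrableOn (fun x => conj (deriv (η : ℝ → ℂ) x) * u x) (Omega α β) :=
    (integrable_conj_mul_planeWave hdη.1.continuous hdη.2.1 a b c lam).integrableOn
  have hW : IntegrableOn (fun x => conj ((η : ℝ → ℂ) x) * closedPlaneWave α a b c lam x)
      (Omega α β) :=
    i1.congr_fun (fun x hx => by
      simp only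
      rw [closedPlaneWave_eq hα hβ a b c lam hx]) (measurableSet_Omega α β)
  have hd : ∀ᵐ x ∂(volume.restrict (Omega α β)),
      HasDerivAt (fun x => conj ((η : ℝ → ℂ) x) * closedPlaneWave α a b c lam x)
        (conj (deriv (η : ℝ → ℂ) x) * u x + κ * lam * (conj ((η : ℝ → ℂ) x) * u x)) x := by
    filter_upwards [ae_restrict_mem (measurableSet_Omega α β)] with x hx
    have h1 : HasDerivAt (η : ℝ → ℂ) (deriv (η : ℝ → ℂ) x) x :=
      (η.2.1.differentiable (by simp) x).hasDerivAt
    convert! h1.star.mul (hasDerivAt_closedPlaneWave hα hβ a b c lam hx) using 1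
    rw [closedPlaneWave_eq hα hβ a b c lam hx]
    simp only [RCLike.star_def]
    ring
  have h := integral_Omega_of_hasDerivAt hα hβ
    ((isAC_of_contDiff η.2.1).conj_mul (isAC_closedPlaneWave hα hβ a b c lam)) hd hW
    (i2.add (i1.const_mul _))
  rw [integral_add i2 (i1.const_mul _), integral_const_mul] at h
  have h2 : planeWaveFunctional α β B a b c lam (testMomentum η) =
      -κ⁻¹ * ∫ x in Omega α β, conj (deriv (η : ℝ → ℂ) x) * u x := by
    rw [← integral_const_mul]
    change ∫ x in Omega α β, conj (κ⁻¹ • deriv (η : ℝ → ℂ) x) * u x = _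
    congr 1
    ext x
    rw [smul_eq_mul, map_mul, map_inv₀, hκc, inv_neg]
    ring
  have h3 : planeWaveFunctional α β B a b c lam η =
      ∫ x in Omega α β, conj ((η : ℝ → ℂ) x) * u x := rfl
  rw [h2, h3]
  have h4 : closedPlaneWave α a b c lam 0 = a := by simp [closedPlaneWave, e_zero]
  have h5 : closedPlaneWave α a b c lam 1 = b * e lam := by
    simp [closedPlaneWave, hα.le, show ¬ (1 : ℝ) ≤ 0 by norm_num]
  have h6 : closedPlaneWave α a b c lam α = b * e (lam * α) := by
    simp [closedPlaneWave, show ¬ α ≤ 0 by linarith]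
  have h7 : closedPlaneWave α a b c lam β = c * e (lam * β) := by
    simp [closedPlaneWave, show ¬ β ≤ 0 by linarith, show ¬ β ≤ α by linarith]
  rw [h4, h5, h6, h7] at h
  have h8 : κ * -κ⁻¹ = -1 := by
    rw [mul_neg, mul_inv_cancel₀ hκ0]
  linear_combination -h + (∫ x in Omega α β, conj (deriv (η : ℝ → ℂ) x) * u x) * h8

/-- The boundary condition on `η` eliminates `η(0)` and `η(α)`. What remains separates the
half-lines from the bounded interval. -/
theorem planeWaveFunctional_testMomentum_of_boundary (hα : 1 < α) (hβ : α < β) (a b c : ℂ)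
    (lam : ℝ) (η : testSpace α β (boundaryMatrix 0 θ φ ψ)) :
    2 * Real.pi * Complex.I *
      (planeWaveFunctional α β (boundaryMatrix 0 θ φ ψ) a b c lam (testMomentum η) -
      lam * planeWaveFunctional α β (boundaryMatrix 0 θ φ ψ) a b c lam η) =
      conj ((η : ℝ → ℂ) β) * e (ψ - θ) * (c * e (θ - ψ + β * lam) + a) +
        conj ((η : ℝ → ℂ) 1) * (e (-ψ) * e lam) * b * (e ψ - e (lam * (α - 1))) := by
  rw [planeWaveFunctional_testMomentum hα hβ]
  have h := η.2.2.2 0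
  rw [iteratedDeriv_zero, boundaryCondition_iff] at h
  have h1 : e (lam * α) = e lam * e (lam * (α - 1)) := by
    rw [← e_add]
    ring_nf
  have h2 := e_neg_mul_e (θ - ψ)
  rw [show -(θ - ψ) = ψ - θ by ring] at h2
  rw [h.1, h.2, map_mul, map_mul, map_neg, conj_e, conj_e, h1, e_add (θ - ψ),
    show -(θ - ψ) = ψ - θ by ring, mul_comm lam β]
  linear_combination -(conj ((η : ℝ → ℂ) β) * c * e (β * lam)) * h2 -
    (conj ((η : ℝ → ℂ) 1) * e lam * b) * e_neg_mul_e ψ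

/-! ### Test functions -/

theorem iteratedDeriv_of_eventuallyEq_const {η : ℝ → ℂ} {p : ℝ} {v : ℂ}
    (h : η =ᶠ[𝓝 p] fun _ => v) (k : ℕ) : iteratedDeriv k η p = if k = 0 then v else 0 := by
  rw [h.iteratedDeriv_eq, iteratedDeriv_const]

/-- Near the four endpoints all derivatives of positive order vanish, so the boundary condition only
concerns the values themselves. -/
theorem mem_testSpace_of_eventuallyEq_const {η : ℝ → ℂ} (h1 : ContDiff ℝ ∞ η)
    (h2 : HasCompactSupport η) {v w : ℂ} (h0 : η =ᶠ[𝓝 0] fun _ => -e (θ - ψ) * v)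
    (h1' : η =ᶠ[𝓝 1] fun _ => w) (hα' : η =ᶠ[𝓝 α] fun _ => e ψ * w)
    (hβ' : η =ᶠ[𝓝 β] fun _ => v) : η ∈ testSpace α β (boundaryMatrix 0 θ φ ψ) := by
  refine ⟨h1, h2, fun k => ?_⟩
  rw [boundaryCondition_iff, iteratedDeriv_of_eventuallyEq_const h0,
    iteratedDeriv_of_eventuallyEq_const h1', iteratedDeriv_of_eventuallyEq_const hα',
    iteratedDeriv_of_eventuallyEq_const hβ']
  split_ifs <;> simp

/-- A smooth bump function at `p`, as a complex function. -/
def complexBump {p : ℝ} (f : ContDiffBump p) (x : ℝ) : ℂ := (f x : ℂ)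

theorem contDiff_complexBump {p : ℝ} (f : ContDiffBump p) : ContDiff ℝ ∞ (complexBump f) :=
  Complex.ofRealCLM.contDiff.comp f.contDiff

theorem hasCompactSupport_complexBump {p : ℝ} (f : ContDiffBump p) :
    HasCompactSupport (complexBump f) :=
  f.hasCompactSupport.comp_left (g := fun x : ℝ => (x : ℂ)) Complex.ofReal_zero

theorem complexBump_eventuallyEq_one {p : ℝ} (f : ContDiffBump p) :
    complexBump f =ᶠ[𝓝 p] fun _ => 1 := by
  filter_upwards [f.eventuallyEq_one] with x hx
  simp [complexBump, hx]

theorem complexBump_of_le_dist {p x : ℝ} (f : ContDiffBump p) (h : f.rOut ≤ |x - p|) :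
    complexBump f x = 0 := by
  rw [complexBump, f.zero_of_le_dist (by rwa [Real.dist_eq]), Complex.ofReal_zero]

theorem complexBump_eventuallyEq_zero {p q : ℝ} (f : ContDiffBump p) (h : f.rOut < |q - p|) :
    complexBump f =ᶠ[𝓝 q] fun _ => 0 := by
  have h1 : ContinuousAt (fun x : ℝ => |x - p|) q := by fun_prop
  filter_upwards [h1.eventually (lt_mem_nhds h)] with x hx
  exact complexBump_of_le_dist f hx.le

theorem exists_testSpace_boundary_values (hα : 1 < α) (hβ : α < β) (v w : ℂ) :
    ∃ η : testSpace α β (boundaryMatrix 0 θ φ ψ), (η : ℝ → ℂ) β = v ∧ (η : ℝ → ℂ) 1 = w := by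
  -- The radius is smaller than all distances between `0, 1, α, β`, so each bump vanishes near the
  -- other three points.
  obtain ⟨δ, hδ, hδ1, hδ2, hδ3⟩ : ∃ δ : ℝ, 0 < δ ∧ δ < 1 ∧ δ < α - 1 ∧ δ < β - α := by
    obtain ⟨δ, h1, h2⟩ := exists_between
      (show (0 : ℝ) < min 1 (min (α - 1) (β - α)) from
        lt_min one_pos (lt_min (by linarith) (by linarith)))
    rw [lt_min_iff, lt_min_iff] at h2
    exact ⟨δ, h1, h2.1, h2.2.1, h2.2.2⟩
  let f (p : ℝ) : ContDiffBump p := ⟨δ / 2, δ, by linarith, by linarith⟩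
  have hf : ∀ p q, δ < |q - p| → complexBump (f p) =ᶠ[𝓝 q] fun _ => 0 := fun p q h =>
    complexBump_eventuallyEq_zero (f p) h
  have hlt : ∀ {p q : ℝ}, δ < q - p → δ < |q - p| := fun h => h.trans_le (le_abs_self _)
  have hlt' : ∀ {p q : ℝ}, δ < q - p → δ < |p - q| := fun h => by
    rw [abs_sub_comm]
    exact hlt h
  let η : ℝ → ℂ := fun x => (-e (θ - ψ) * v) * complexBump (f 0) x + w * complexBump (f 1) x +
    (e ψ * w) * complexBump (f α) x + v * complexBump (f β) x
  have hη : η ∈ testSpace α β (boundaryMatrix 0 θ φ ψ) := by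
    refine mem_testSpace_of_eventuallyEq_const (v := v) (w := w) ?_ ?_ ?_ ?_ ?_ ?_
    · exact (((contDiff_const.mul (contDiff_complexBump _)).add
        (contDiff_const.mul (contDiff_complexBump _))).add
        (contDiff_const.mul (contDiff_complexBump _))).add
        (contDiff_const.mul (contDiff_complexBump _))
    · exact (((hasCompactSupport_complexBump _).mul_left.add
        (hasCompactSupport_complexBump _).mul_left).add
        (hasCompactSupport_complexBump _).mul_left).add
        (hasCompactSupport_complexBump _).mul_left
    · filter_upwards [complexBump_eventuallyEq_one (f 0), hf 1 0 (hlt' (by linarith)),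
        hf α 0 (hlt' (by linarith)), hf β 0 (hlt' (by linarith))] with x h0 h1 h2 h3
      simp [η, h0, h1, h2, h3]
    · filter_upwards [complexBump_eventuallyEq_one (f 1), hf 0 1 (hlt (by linarith)),
        hf α 1 (hlt' (by linarith)), hf β 1 (hlt' (by linarith))] with x h0 h1 h2 h3
      simp [η, h0, h1, h2, h3]
    · filter_upwards [complexBump_eventuallyEq_one (f α), hf 0 α (hlt (by linarith)),
        hf 1 α (hlt (by linarith)), hf β α (hlt' (by linarith))] with x h0 h1 h2 h3
      simp [η, h0, h1, h2, h3]
    · filter_upwards [complexBump_eventuallyEq_one (f β), hf 0 β (hlt (by linarith)),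
        hf 1 β (hlt (by linarith)), hf α β (hlt (by linarith))] with x h0 h1 h2 h3
      simp [η, h0, h1, h2, h3]
  refine ⟨⟨η, hη⟩, ?_, ?_⟩
  · have h0 := (complexBump_eventuallyEq_one (f β)).eq_of_nhds
    have h1 := (hf 0 β (hlt (by linarith))).eq_of_nhds
    have h2 := (hf 1 β (hlt (by linarith))).eq_of_nhds
    have h3 := (hf α β (hlt (by linarith))).eq_of_nhds
    simp [η, h0, h1, h2, h3]
  · have h0 := (complexBump_eventuallyEq_one (f 1)).eq_of_nhds
    have h1 := (hf 0 1 (hlt (by linarith))).eq_of_nhds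
    have h2 := (hf α 1 (hlt' (by linarith))).eq_of_nhds
    have h3 := (hf β 1 (hlt' (by linarith))).eq_of_nhds
    simp [η, h0, h1, h2, h3]

/-- A plane wave with nonzero amplitude on some interval in `Ω` is not the zero functional. -/
theorem planeWaveFunctional_ne_zero {a b c z : ℂ} {lam p r : ℝ} (hr : 0 < r) (hz : z ≠ 0)
    (hsub : Ioo (p - r) (p + r) ⊆ Omega α β)
    (h : ∀ x ∈ Ioo (p - r) (p + r), planeWave α β a b c lam x = z * e (lam * x))
    (h0 : r < |0 - p|) (h1 : r < |1 - p|) (hα : r < |α - p|) (hβ : r < |β - p|) :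
    planeWaveFunctional α β (boundaryMatrix 0 θ φ ψ) a b c lam ≠ 0 := by
  let f : ContDiffBump p := ⟨r / 2, r, by linarith, by linarith⟩
  -- The phase cancels that of the plane wave, and the pairing becomes `z` times the positive
  -- integral of the bump.
  let η : ℝ → ℂ := fun x => complexBump f x * e (lam * x)
  have hzero : ∀ q, r < |q - p| → η =ᶠ[𝓝 q] fun _ => 0 := fun q hq => by
    filter_upwards [complexBump_eventuallyEq_zero f hq] with x hx
    simp [η, hx]
  have hη : η ∈ testSpace α β (boundaryMatrix 0 θ φ ψ) :=
    mem_testSpace_of_eventuallyEq_const (v := 0) (w := 0)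
      ((contDiff_complexBump f).mul (contDiff_e_mul lam))
      (hasCompactSupport_complexBump f).mul_right (by simpa using hzero 0 h0)
      (by simpa using hzero 1 h1) (by simpa using hzero α hα) (by simpa using hzero β hβ)
  intro hT
  have h2 : planeWaveFunctional α β (boundaryMatrix 0 θ φ ψ) a b c lam ⟨η, hη⟩ =
      z * ((∫ x, f x : ℝ) : ℂ) := by
    change ∫ x in Omega α β, conj (η x) * planeWave α β a b c lam x = _
    have hin : ∀ x, x ∉ Ioo (p - r) (p + r) → complexBump f x = 0 := fun x hx =>
      complexBump_of_le_dist f (by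
        change r ≤ |x - p|
        by_contra hlt
        rw [not_le, abs_lt] at hlt
        exact hx ⟨by linarith, by linarith⟩)
    rw [setIntegral_eq_integral_of_forall_compl_eq_zero fun x hx => by
        simp [η, hin x fun h => hx (hsub h)],
      ← integral_complex_ofReal, ← integral_const_mul]
    congr 1
    ext x
    by_cases hx : x ∈ Ioo (p - r) (p + r)
    · rw [h x hx]
      simp only [η, complexBump, map_mul, Complex.conj_ofReal, conj_e]
      linear_combination (f x * z) * e_neg_mul_e (lam * x)
    · have h3 := hin x hx
      simp only [η, h3, zero_mul, map_zero]
      rw [complexBump] at h3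
      rw [h3, mul_zero]
  rw [hT, LinearMap.zero_apply] at h2
  have h3 : ((∫ x, f x : ℝ) : ℂ) ≠ 0 := by
    exact_mod_cast (f.integral_pos (μ := volume)).ne'
  exact mul_ne_zero hz h3 h2.symm

theorem planeWaveFunctional_ne_zero_of_ne_zero (hα : 1 < α) (hβ : α < β) {a b c : ℂ}
    (h : ¬ (a = 0 ∧ b = 0 ∧ c = 0)) (lam : ℝ) :
    planeWaveFunctional α β (boundaryMatrix 0 θ φ ψ) a b c lam ≠ 0 := by
  by_cases ha : a = 0
  · by_cases hb : b = 0
    · have hc : c ≠ 0 := fun hc => h ⟨ha, hb, hc⟩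
      have hsub : ∀ x ∈ Ioo (β + 1 - 1 / 2) (β + 1 + 1 / 2), β < x := fun x hx => by
        linarith [hx.1]
      refine planeWaveFunctional_ne_zero (p := β + 1) (r := 1 / 2) (by norm_num) hc
        (fun x hx => Ioi_subset_Omega (hsub x hx))
        (fun x hx => planeWave_of_mem_Ioi hα hβ _ _ _ _ (hsub x hx)) ?_ ?_ ?_ ?_ <;>
      · rw [abs_sub_comm]
        exact lt_of_lt_of_le (by linarith) (le_abs_self _)
    · have hsub : ∀ x ∈ Ioo ((1 + α) / 2 - (α - 1) / 4) ((1 + α) / 2 + (α - 1) / 4),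
          x ∈ Ioo 1 α := fun x hx => ⟨by linarith [hx.1], by linarith [hx.2]⟩
      refine planeWaveFunctional_ne_zero (p := (1 + α) / 2) (r := (α - 1) / 4) (by linarith) hb
        (fun x hx => Ioo_subset_Omega (hsub x hx))
        (fun x hx => planeWave_of_mem_Ioo hβ _ _ _ _ (hsub x hx)) ?_ ?_ ?_ ?_
      · rw [abs_sub_comm]
        exact lt_of_lt_of_le (by linarith) (le_abs_self _)
      · rw [abs_sub_comm]
        exact lt_of_lt_of_le (by linarith) (le_abs_self _)
      · exact lt_of_lt_of_le (by linarith) (le_abs_self _)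
      · exact lt_of_lt_of_le (by linarith) (le_abs_self _)
  · have hsub : ∀ x ∈ Ioo ((-1 : ℝ) - 1 / 2) (-1 + 1 / 2), x < 0 := fun x hx => by
      linarith [hx.2]
    refine planeWaveFunctional_ne_zero (p := -1) (r := 1 / 2) (by norm_num) ha
      (fun x hx => Iio_subset_Omega (hsub x hx))
      (fun x hx => planeWave_of_mem_Iio (by linarith) _ _ _ _ (hsub x hx)) ?_ ?_ ?_ ?_ <;>
    exact lt_of_lt_of_le (by linarith) (le_abs_self _)

/-! ### The generalized eigenfunctions -/

/-- Test functions with values `(1, 0)` and `(0, 1)` at `(β, 1)` isolate the two boundary terms. One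
gives the relation between `a` and `c`, the other gives `b = 0` or the quantization of `lam`. -/
theorem isGeneralizedEigenfunction_planeWave_iff (hα : 1 < α) (hβ : α < β) (lam : ℝ)
    (a b c : ℂ) :
    IsGeneralizedEigenfunction α β (boundaryMatrix 0 θ φ ψ) lam (planeWave α β a b c lam) ↔
      ¬ (a = 0 ∧ b = 0 ∧ c = 0) ∧ a = -c * e (θ - ψ + β * lam) ∧
        (b = 0 ∨ lam ∈ boundStates α ψ) := by
  set B := boundaryMatrix 0 θ φ ψ with hB
  have hκ0 : (2 * Real.pi * Complex.I : ℂ) ≠ 0 := Complex.two_pi_I_ne_zero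
  constructor
  · rintro ⟨-, T, hT, -, hT0, hTe⟩
    have hTT : T = planeWaveFunctional α β B a b c lam := LinearMap.ext hT
    subst hTT
    refine ⟨?_, ?_, ?_⟩
    · rintro ⟨rfl, rfl, rfl⟩
      refine hT0 (LinearMap.ext fun η => ?_)
      rw [hT]
      simp [planeWave]
    · obtain ⟨η, h1, h2⟩ := exists_testSpace_boundary_values (θ := θ) (φ := φ) (ψ := ψ) hα hβ 1 0
      have h3 := planeWaveFunctional_testMomentum_of_boundary hα hβ a b c lam η
      rw [hTe η, sub_self, mul_zero, h1, h2, map_one, map_zero] at h3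
      have h4 : c * e (θ - ψ + β * lam) + a = 0 := by
        simpa [e_ne_zero] using h3.symm
      linear_combination h4
    · obtain ⟨η, h1, h2⟩ := exists_testSpace_boundary_values (θ := θ) (φ := φ) (ψ := ψ) hα hβ 0 1
      have h3 := planeWaveFunctional_testMomentum_of_boundary hα hβ a b c lam η
      rw [hTe η, sub_self, mul_zero, h1, h2, map_one, map_zero] at h3
      have h4 : b = 0 ∨ e ψ - e (lam * (α - 1)) = 0 := by
        simpa [e_ne_zero] using h3.symm
      refine h4.imp_right fun h => ?_
      rw [mem_boundStates_iff hα]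
      exact (sub_eq_zero.mp h).symm
  · rintro ⟨h0, ha, hb⟩
    refine ⟨fun R => integrableOn_planeWave a b c lam R, planeWaveFunctional α β B a b c lam,
      fun η => rfl, isDistribution_planeWaveFunctional B a b c lam,
      planeWaveFunctional_ne_zero_of_ne_zero hα hβ h0 lam, fun η => ?_⟩
    have h3 := planeWaveFunctional_testMomentum_of_boundary hα hβ a b c lam η
    have h4 : c * e (θ - ψ + β * lam) + a = 0 := by
      rw [ha]
      ring
    have h5 : b * (e ψ - e (lam * (α - 1))) = 0 := by
      rcases hb with rfl | hb
      · exact zero_mul _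
      · rw [(mem_boundStates_iff hα lam).mp hb, sub_self, mul_zero]
    rw [h4, mul_zero, zero_add, mul_assoc _ b, h5, mul_zero, mul_eq_zero] at h3
    exact sub_eq_zero.mp (h3.resolve_left hκ0)

/-! ### The point spectrum -/

theorem isSpectralRepresentation_expansionEquiv (hα : 1 < α) (hβ : α < β) :
    IsSpectralRepresentation (momentum α β (boundaryMatrix 0 θ φ ψ)) (spectralMeasure α ψ)
      (expansionEquiv hα hβ θ ψ) :=
  (isWaveTransform_expansionEquiv hα hβ).isSpectralRepresentation hα hβ

theorem mem_opEigenspace_momentum_iff (hα : 1 < α) (hβ : α < β) {lam : ℝ}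
    (hl : lam ∈ boundStates α ψ) (f : L2Omega α β) :
    f ∈ opEigenspace (momentum α β (boundaryMatrix 0 θ φ ψ)) (lam : ℂ) ↔
      ∃ b : ℂ, f =ᵐ[volume.restrict (Omega α β)] planeWave α β 0 b 0 lam := by
  have h0 : (α : ℂ) - 1 ≠ 0 := by
    exact_mod_cast (show α - 1 ≠ 0 by linarith)
  have hU : ∀ b : ℂ, ∀ g : L2Omega α β,
      g =ᵐ[volume.restrict (Omega α β)] planeWave α β 0 b 0 lam →
      expansionEquiv hα hβ θ ψ g =ᵐ[spectralMeasure α ψ]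
        ({lam} : Set ℝ).indicator fun _ => (α - 1) * b := fun b g hg =>
    (coeFn_expansionEquiv hα hβ g).trans (expansion_of_ae_eq_planeWave hα hβ hl b hg)
  rw [(isSpectralRepresentation_expansionEquiv hα hβ).mem_opEigenspace_iff]
  constructor
  · intro h
    -- The bound state with amplitude `b` has coefficient `(α - 1) b` at `lam`, which fixes `b`.
    set b : ℂ := expansionEquiv hα hβ θ ψ f lam / (α - 1) with hb
    have hm := memLp_planeWave_bound hβ b lam
    have hfb : f = hm.toLp _ := by
      apply (expansionEquiv hα hβ θ ψ).injective
      refine Lp.ext ?_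
      filter_upwards [h, hU b (hm.toLp _) hm.coeFn_toLp] with ξ h1 h2
      rw [h2]
      by_cases hξ : ξ = lam
      · subst hξ
        rw [indicator_of_mem (mem_singleton ξ), hb, mul_div_cancel₀ _ h0]
      · rw [indicator_of_notMem (mem_singleton_iff.not.mpr hξ), h1 (by exact_mod_cast hξ)]
    refine ⟨b, ?_⟩
    rw [hfb]
    exact hm.coeFn_toLp
  · rintro ⟨b, hb⟩
    filter_upwards [hU b f hb] with ξ h1 hξ
    rw [h1, indicator_of_notMem (mem_singleton_iff.not.mpr (by exact_mod_cast hξ))]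

theorem planeWave_bound_eq_smul (b : ℂ) (lam : ℝ) :
    planeWave α β 0 b 0 lam = b • planeWave α β 0 1 0 lam := by
  ext x
  simp only [planeWave, Pi.smul_apply, smul_eq_mul]
  ring

theorem finrank_opEigenspace_momentum (hα : 1 < α) (hβ : α < β) {lam : ℝ}
    (hl : lam ∈ boundStates α ψ) :
    Module.finrank ℂ (opEigenspace (momentum α β (boundaryMatrix 0 θ φ ψ)) (lam : ℂ)) = 1 := by
  have hm := memLp_planeWave_bound hβ 1 lam
  have hmem : hm.toLp _ ∈ opEigenspace (momentum α β (boundaryMatrix 0 θ φ ψ)) (lam : ℂ) :=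
    (mem_opEigenspace_momentum_iff hα hβ hl _).mpr ⟨1, hm.coeFn_toLp⟩
  refine finrank_eq_one ⟨hm.toLp _, hmem⟩ ?_ ?_
  · intro h
    have h0 : hm.toLp _ = 0 := congrArg Subtype.val h
    -- The bound state is nonzero because its transform takes the value `α - 1 ≠ 0` at the atom
    -- `lam`.
    have h1 := expansion_of_ae_eq_planeWave (θ := θ) hα hβ hl 1 hm.coeFn_toLp
    have h2 := ((ae_spectralMeasure_iff hα ψ).mp
      ((coeFn_expansionEquiv (θ := θ) hα hβ (hm.toLp _)).trans h1)).2 lam hl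
    have h3 := ((ae_spectralMeasure_iff hα ψ).mp
      (Lp.coeFn_zero ℂ 2 (spectralMeasure α ψ))).2 lam hl
    rw [h0, map_zero, h3, indicator_of_mem (mem_singleton lam), Pi.zero_apply, mul_one] at h2
    have h4 : α - 1 = 0 := by exact_mod_cast h2.symm
    linarith
  · rintro ⟨f, hf⟩
    obtain ⟨b, hb⟩ := (mem_opEigenspace_momentum_iff hα hβ hl f).mp hf
    refine ⟨b, Subtype.ext (Lp.ext ?_)⟩
    refine (Lp.coeFn_smul b (hm.toLp _)).trans ?_
    filter_upwards [hb, hm.coeFn_toLp] with x h1 h2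
    rw [h1, Pi.smul_apply, h2, planeWave_bound_eq_smul b]
    rfl

/-- The transform of an eigenvector is concentrated on the real points equal to `z`. Outside `Λ`
there are none or a single one of `ν`-measure zero, so the eigenvector vanishes. -/
theorem opEigenvalues_momentum (hα : 1 < α) (hβ : α < β) :
    opEigenvalues (momentum α β (boundaryMatrix 0 θ φ ψ)) =
      (fun t : ℝ => (t : ℂ)) '' boundStates α ψ := by
  ext z
  constructor
  · intro hz
    by_contra hz'
    refine hz ((Submodule.eq_bot_iff _).mpr fun f hf => ?_)
    rw [(isSpectralRepresentation_expansionEquiv hα hβ).mem_opEigenspace_iff,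
      ae_spectralMeasure_iff hα] at hf
    have h0 : expansionEquiv hα hβ θ ψ f = 0 := by
      refine Lp.ext (Filter.EventuallyEq.trans ?_ (Lp.coeFn_zero _ _ _).symm)
      refine (ae_spectralMeasure_iff hα ψ).mpr ⟨?_, fun ξ hξ => ?_⟩
      · have hne : ∀ᵐ ξ : ℝ, (ξ : ℂ) ≠ z := by
          have h1 : ∀ᵐ ξ : ℝ, ξ ≠ z.re := by simp [ae_iff]
          filter_upwards [h1] with ξ hξ h2
          exact hξ (by rw [← h2, Complex.ofReal_re])
        filter_upwards [hf.1, hne] with ξ h1 h2 using h1 h2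
      · exact hf.2 ξ hξ fun h => hz' ⟨ξ, hξ, h⟩
    exact (LinearIsometryEquiv.map_eq_zero_iff _).mp h0
  · rintro ⟨t, ht, rfl⟩ hbot
    have h1 := finrank_opEigenspace_momentum (θ := θ) (φ := φ) hα hβ ht
    rw [hbot, finrank_bot] at h1
    exact zero_ne_one h1

end TwoIntervals

end

theorem theorem3p8 (α β θ φ ψ : ℝ) (hα : 1 < α) (hβ : α < β) :
    -- the operator `P_B` for `w = 0` is self-adjoint
    IsSelfAdjoint (momentum α β (boundaryMatrix 0 θ φ ψ)) ∧
    -- its spectrum is the real line, with uniform multiplicity one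
    opSpectrum (momentum α β (boundaryMatrix 0 θ φ ψ)) = Set.range (fun t : ℝ => (t : ℂ)) ∧
    HasUniformMultiplicityOne (momentum α β (boundaryMatrix 0 θ φ ψ)) ∧
    -- mixture of continuous and discrete spectrum: the eigenfunction expansion
    (∃ U : L2Omega α β ≃ₗᵢ[ℂ] Lp ℂ 2 (spectralMeasure α ψ),
      IsSpectralRepresentation (momentum α β (boundaryMatrix 0 θ φ ψ)) (spectralMeasure α ψ) U ∧
      (∀ f : L2Omega α β, Integrable f (volume.restrict (Omega α β)) →
        ∀ᵐ lam : ℝ, U f lam = ∫ x in Omega α β,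
          conj (planeWave α β (-e (θ - ψ + β * lam)) 0 1 lam x) * f x) ∧
      (∀ f : L2Omega α β, ∀ lam ∈ boundStates α ψ,
        U f lam = ∫ x in Omega α β, conj (planeWave α β 0 1 0 lam x) * f x)) ∧
    -- the generalized eigenfunctions of the form `(a χ₋ + b χ₀ + c χ₊) e_lam`
    (∀ (lam : ℝ) (a b c : ℂ),
      IsGeneralizedEigenfunction α β (boundaryMatrix 0 θ φ ψ) lam (planeWave α β a b c lam) ↔
        ¬ (a = 0 ∧ b = 0 ∧ c = 0) ∧ a = -c * e (θ - ψ + β * lam) ∧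
          (b = 0 ∨ lam ∈ boundStates α ψ)) ∧
    -- the embedded eigenvalues, each of multiplicity one, and their eigenfunctions
    opEigenvalues (momentum α β (boundaryMatrix 0 θ φ ψ)) =
      (fun t : ℝ => (t : ℂ)) '' boundStates α ψ ∧
    (∀ lam ∈ boundStates α ψ,
      Module.finrank ℂ (opEigenspace (momentum α β (boundaryMatrix 0 θ φ ψ)) (lam : ℂ)) = 1 ∧
      ∀ f : L2Omega α β,
        f ∈ opEigenspace (momentum α β (boundaryMatrix 0 θ φ ψ)) (lam : ℂ) ↔
          ∃ b : ℂ, f =ᵐ[volume.restrict (Omega α β)] planeWave α β 0 b 0 lam) := by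
  have hrep := isSpectralRepresentation_expansionEquiv (θ := θ) (φ := φ) (ψ := ψ) hα hβ
  have := isLocallyFiniteMeasure_spectralMeasure hα ψ
  exact ⟨hrep.isSelfAdjoint, hrep.opSpectrum_eq,
    ⟨_, sigmaFinite_spectralMeasure hα ψ, _, hrep⟩,
    ⟨_, hrep, expansionEquiv_scattering hα hβ, expansionEquiv_bound hα hβ⟩,
    isGeneralizedEigenfunction_planeWave_iff hα hβ, opEigenvalues_momentum hα hβ,
    fun lam hl => ⟨finrank_opEigenspace_momentum hα hβ hl,
      mem_opEigenspace_momentum_iff hα hβ hl⟩⟩
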